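/- For $l\ge 0$ let $V_l$ be the $l$-th irreducible representation of $SO(3)$, of dimension $2l+1$, realized on the real harmonic homogeneous polynomials of degree $l$ in three variables with $(R\cdot h)(x)=h(R^{-1}x)$. Given a basis of each $V_l$, write $D^l(R)\in\mathbb{R}^{(2l+1)\times(2l+1)}$ for the matrix of $R\in SO(3)$ in it, and call the bases orthogonal if every $D^l(R)$ is an orthogonal matrix. For $l\ge 0$ and a parity $p\in\{1,-1\}$, the irrep $(l,p)$ of $O(3)$ is the representation on $\mathbb{R}^{2l+1}$ in which $R$ acts by $D^l(R)$ if $\det R=1$ and by $p\,D^l(-R)$ if $\det R=-1$. Clebsch–Gordan coefficients for $(l_1,l_2,l_3)$ are real numbers $C^{l_1,l_2,l_3}_{ijk}$ ($1\le i\le 2l_1+1$, $1\le j\le 2l_2+1$, $1\le k\le 2l_3+1$) such that $$C^{l_1,l_2,l_3}_{lmn}=\sum_{i,j,k}C^{l_1,l_2,l_3}_{ijk}\,D^{l_1}_{il}(R)\,D^{l_2}_{jm}(R)\,D^{l_3}_{kn}(R)\quad\text{for all }R\in SO(3),\ l,m,n,\qquad \sum_{i,j}C^{l_1,l_2,l_3}_{ijk}C^{l_1,l_2,l_3}_{ijk'}=\delta_{kk'}.$$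 A path from $(l_1,p_1)$ and $(l_2,p_2)$ to $(l_3,p_3)$ is allowed if $|l_1-l_2|\le l_3\le l_1+l_2$ and $p_1p_2=p_3$. Then orthogonal bases exist, and for every choice of orthogonal bases: 1. Clebsch–Gordan coefficients exist for all $(l_1,l_2,l_3)$ with $|l_1-l_2|\le l_3\le l_1+l_2$. 2. Fix any choice of such coefficients. Let $X=\bigoplus_{u=1}^{n_1}(l_u,p_u)$, $Y=\bigoplus_{v=1}^{n_2}(l'_v,p'_v)$ and $Z=\bigoplus_{w=1}^{n_3}(l''_w,p''_w)$ be finite direct sums of irreps of $O(3)$ (repetitions allowed). A bilinear map $f:X\times Y\to Z$ is $O(3)$-equivariant if and only if it is a weighted linear combination of allowed paths, that is, if and only if there are a set $P$ of triples $(u,v,w)$, for each of which the path from $(l_u,p_u)$ and $(l'_v,p'_v)$ to $(l''_w,p''_w)$ is allowed, and real weights $\omega_{uvw}$ such that for all $x\in X$, $y\in Y$ and all $w,k$ $$f(x,y)_{w,k}=\sum_{u,v:\,(u,v,w)\in P}\omega_{uvw}\sum_{i,j}C^{l_u,l'_v,l''_w}_{ijk}\,x_{u,i}\,y_{v,j}.$$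 -/

import Mathlib

namespace E3nn

open MvPolynomial

/-- The group `O(3)` of real orthogonal `3 × 3` matrices. -/
abbrev O3 := Matrix.orthogonalGroup (Fin 3) ℝ

/-- The group `SO(3)` of rotations. -/
abbrev SO3 := Matrix.specialOrthogonalGroup (Fin 3) ℝ

/-! ### The `l`-irrep of `SO(3)`: harmonic homogeneous polynomials of degree `l` -/

/-- The Laplacian on real polynomials in three variables. -/
noncomputable def laplacian : MvPolynomial (Fin 3) ℝ →ₗ[ℝ] MvPolynomial (Fin 3) ℝ :=
  ∑ i : Fin 3, (pderiv i).toLinearMap ∘ₗ (pderiv i).toLinearMap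

/-- Real harmonic polynomials in three variables, homogeneous of degree `l`. -/
noncomputable def Harm (l : ℕ) : Submodule ℝ (MvPolynomial (Fin 3) ℝ) :=
  homogeneousSubmodule (Fin 3) ℝ l ⊓ LinearMap.ker laplacian

/-- Substitution `h ↦ (x ↦ h (Aᵀ x))`; for orthogonal `A` this is `x ↦ h (A⁻¹ x)`. -/
noncomputable def subst (A : Matrix (Fin 3) (Fin 3) ℝ) :
    MvPolynomial (Fin 3) ℝ →ₐ[ℝ] MvPolynomial (Fin 3) ℝ :=
  aeval fun i => ∑ j, C (A j i) * X j

theorem subst_one : subst 1 = AlgHom.id ℝ _ := by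
  ext1 i
  simp [subst, Matrix.one_apply, apply_ite C, ite_mul]

theorem subst_mul (A B : Matrix (Fin 3) (Fin 3) ℝ) :
    subst (A * B) = (subst A).comp (subst B) := by
  ext1 i
  simp only [subst, aeval_X, AlgHom.comp_apply, map_sum, map_mul, algHom_C, algebraMap_eq,
    Matrix.mul_apply, Finset.sum_mul, Finset.mul_sum]
  rw [Finset.sum_comm]
  refine Finset.sum_congr rfl fun j _ => Finset.sum_congr rfl fun k _ => ?_
  ring

theorem pderiv_subst (A : Matrix (Fin 3) (Fin 3) ℝ) (j : Fin 3) (h : MvPolynomial (Fin 3) ℝ) :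
    pderiv j (subst A h) = ∑ i, C (A j i) * subst A (pderiv i h) := by
  induction h using MvPolynomial.induction_on with
  | C a => simp [subst]
  | add p q hp hq => simp only [map_add, hp, hq, mul_add, Finset.sum_add_distrib]
  | mul_X p n hp =>
    have hX : pderiv j (subst A (X n)) = C (A j n) := by
      simp [subst, pderiv_X, Pi.single_apply]
    simp only [map_mul, Derivation.leibniz, hp, hX, smul_eq_mul, pderiv_X, map_add, mul_add,
      Finset.sum_add_distrib, Finset.mul_sum]
    congr 1
    · rw [Finset.sum_eq_single n]
      · simp [mul_comm]
      · intro b _ hb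
        simp [hb.symm]
      · simp
    · exact Finset.sum_congr rfl fun i _ => by ring

theorem laplacian_subst (A : Matrix (Fin 3) (Fin 3) ℝ) (hA : A.transpose * A = 1)
    (h : MvPolynomial (Fin 3) ℝ) : laplacian (subst A h) = subst A (laplacian h) := by
  have key : ∀ i k, ∑ j, A j i * A j k = (1 : Matrix (Fin 3) (Fin 3) ℝ) i k := by
    intro i k
    rw [← hA, Matrix.mul_apply]
    rfl
  simp only [laplacian, LinearMap.sum_apply, LinearMap.comp_apply,
    Derivation.coeFn_coe, pderiv_subst, map_sum, Derivation.leibniz, pderiv_C, mul_zero,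
    add_zero, smul_eq_mul, Finset.mul_sum]
  calc _ = ∑ i, ∑ k, C (∑ j, A j i * A j k) * subst A (pderiv k (pderiv i h)) := by
        rw [Finset.sum_comm]
        refine Finset.sum_congr rfl fun i _ => ?_
        rw [Finset.sum_comm]
        refine Finset.sum_congr rfl fun k _ => ?_
        rw [map_sum, Finset.sum_mul]
        refine Finset.sum_congr rfl fun j _ => ?_
        rw [map_mul]
        ring
    _ = _ := by
        simp only [key, Matrix.one_apply, apply_ite C, map_one, map_zero, ite_mul, one_mul,
          zero_mul, Finset.sum_ite_eq, Finset.mem_univ, if_true]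

theorem subst_mem_harm {l : ℕ} (R : SO3) {h : MvPolynomial (Fin 3) ℝ} (hh : h ∈ Harm l) :
    subst R.1 h ∈ Harm l := by
  refine ⟨?_, ?_⟩
  · have h1 : (h : MvPolynomial (Fin 3) ℝ).IsHomogeneous l := hh.1
    have := h1.aeval (n := 1) (fun i => ∑ j, C (R.1 j i) * X j)
      (fun i => IsHomogeneous.sum _ _ _ fun j _ => isHomogeneous_C_mul_X _ _)
    rw [one_mul] at this
    exact this
  · have h2 : laplacian h = 0 := hh.2
    change laplacian (subst R.1 h) = 0
    rw [laplacian_subst _ ((Matrix.mem_orthogonalGroup_iff' _ _).1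
      ((Matrix.mem_specialOrthogonalGroup_iff).1 R.2).1), h2, map_zero]

/-- The `l`-irrep of `SO(3)`: rotations act on harmonic homogeneous polynomials of degree `l` by
`(R · h)(x) = h (R⁻¹ x)`. -/
noncomputable def harmRep (l : ℕ) : Representation ℝ SO3 (Harm l) where
  toFun R := (subst R.1).toLinearMap.restrict fun _ hh => subst_mem_harm R hh
  map_one' := by
    ext1 h
    apply Subtype.ext
    change subst (1 : Matrix (Fin 3) (Fin 3) ℝ) h.1 = h.1
    rw [subst_one]
    rfl
  map_mul' R S := by
    ext1 h
    apply Subtype.ext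
    change subst (R.1 * S.1) h.1 = subst R.1 (subst S.1 h.1)
    rw [subst_mul]
    rfl

/-! ### Irreps of `O(3)` in coordinates -/

/-- A choice, for every `l`, of `2l+1` real coordinates on the `l`-irrep of `SO(3)`. -/
abbrev Coordinates := ∀ l : ℕ, Module.Basis (Fin (2 * l + 1)) ℝ (Harm l)

/-- The real matrix `D^l(R)` of the `l`-irrep in the chosen coordinates. -/
noncomputable def D (b : Coordinates) (l : ℕ) :
    SO3 →* Matrix (Fin (2 * l + 1)) (Fin (2 * l + 1)) ℝ where
  toFun R := LinearMap.toMatrix (b l) (b l) (harmRep l R)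
  map_one' := by rw [map_one, LinearMap.toMatrix_one]
  map_mul' R S := by rw [map_mul, LinearMap.toMatrix_mul]

/-- The coordinates are orthogonal if every `D^l(R)` is an orthogonal matrix. -/
def Coordinates.IsOrthogonal (b : Coordinates) : Prop :=
  ∀ l R, D b l R ∈ Matrix.orthogonalGroup (Fin (2 * l + 1)) ℝ

theorem det_mul_det (R : O3) : R.1.det * R.1.det = 1 := by
  have h := congrArg Matrix.det ((Matrix.mem_orthogonalGroup_iff _ _).1 R.2)
  rwa [Matrix.det_mul, Matrix.det_transpose, Matrix.det_one] at h

/-- The rotation `det(R) R` underlying `R ∈ O(3)`: `R` itself if `det R = 1`, and `-R` (that is, `R`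
composed with the inversion) if `det R = -1`. -/
noncomputable def rotationPart : O3 →* SO3 where
  toFun R := ⟨R.1.det • R.1, by
    refine Matrix.mem_specialOrthogonalGroup_iff.2 ⟨?_, ?_⟩
    · rw [Matrix.mem_orthogonalGroup_iff, Matrix.transpose_smul, Matrix.smul_mul, Matrix.mul_smul,
        smul_smul, det_mul_det, one_smul]
      exact (Matrix.mem_orthogonalGroup_iff _ _).1 R.2
    · rw [Matrix.det_smul, Fintype.card_fin]
      linear_combination (R.1.det * R.1.det + 1) * det_mul_det R⟩
  map_one' := by
    apply Subtype.ext
    simp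
  map_mul' R S := by
    apply Subtype.ext
    simp [Matrix.det_mul, smul_smul, mul_comm]

/-- An irrep of `O(3)`: the order `l` and the parity `p = ±1`. -/
structure Irrep where
  /-- the order -/
  l : ℕ
  /-- the parity, `1` (even) or `-1` (odd) -/
  p : ℤˣ

/-- The dimension `2l+1` of an irrep. -/
abbrev Irrep.dim (ρ : Irrep) : ℕ := 2 * ρ.l + 1

/-- The matrix of `R ∈ O(3)` in the irrep `(l, p)`: `D^l` of the rotation underlying `R`, times the
parity `p` if `R` involves the inversion (`det R = -1`). -/
noncomputable def Irrep.mat (b : Coordinates) (ρ : Irrep) (R : O3) :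
    Matrix (Fin ρ.dim) (Fin ρ.dim) ℝ :=
  (if R.1.det = 1 then 1 else ((ρ.p : ℤ) : ℝ)) • D b ρ.l (rotationPart R)

/-- The real vector space underlying the direct sum of a finite list of irreps. -/
abbrev Space {n : ℕ} (ρ : Fin n → Irrep) : Type := ∀ a : Fin n, Fin (ρ a).dim → ℝ

/-- The (blockwise) action of `O(3)` on a direct sum of irreps. -/
noncomputable def act (b : Coordinates) {n : ℕ} (ρ : Fin n → Irrep) (R : O3) (x : Space ρ) :
    Space ρ :=
  fun a => ((ρ a).mat b R).mulVec (x a)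

/-- Equivariance of a bilinear map between direct sums of irreps of `O(3)`. -/
def IsEquivariant (b : Coordinates) {n₁ n₂ n₃ : ℕ} {ρ₁ : Fin n₁ → Irrep} {ρ₂ : Fin n₂ → Irrep}
    {ρ₃ : Fin n₃ → Irrep} (f : Space ρ₁ →ₗ[ℝ] Space ρ₂ →ₗ[ℝ] Space ρ₃) : Prop :=
  ∀ (R : O3) (x : Space ρ₁) (y : Space ρ₂),
    f (act b ρ₁ R x) (act b ρ₂ R y) = act b ρ₃ R (f x y)

/-! ### Clebsch–Gordan coefficients and paths -/

/-- `|l₁ - l₂| ≤ l₃ ≤ l₁ + l₂`. -/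
def Triangle (l₁ l₂ l₃ : ℕ) : Prop :=
  |(l₁ : ℤ) - (l₂ : ℤ)| ≤ (l₃ : ℤ) ∧ l₃ ≤ l₁ + l₂

/-- Tables `C^{l₁,l₂,l₃}_{ijk}` of real coefficients. -/
abbrev Coefficients :=
  ∀ l₁ l₂ l₃ : ℕ, Fin (2 * l₁ + 1) → Fin (2 * l₂ + 1) → Fin (2 * l₃ + 1) → ℝ

/-- `C` is a system of Clebsch–Gordan coefficients for `(l₁, l₂, l₃)`:
`C_{lmn} = ∑ C_{ijk} D^{l₁}_{il}(R) D^{l₂}_{jm}(R) D^{l₃}_{kn}(R)` for all rotations `R`, and the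
vectors `(C_{ijk})_{ij}` of the tensor product space, `k = 1, …, 2l₃+1`, are orthonormal. -/
def IsClebschGordan (b : Coordinates) (l₁ l₂ l₃ : ℕ)
    (C : Fin (2 * l₁ + 1) → Fin (2 * l₂ + 1) → Fin (2 * l₃ + 1) → ℝ) : Prop :=
  (∀ (R : SO3) l m n,
    C l m n = ∑ i, ∑ j, ∑ k, C i j k * D b l₁ R i l * D b l₂ R j m * D b l₃ R k n) ∧
  ∀ k k', ∑ i, ∑ j, C i j k * C i j k' = if k = k' then 1 else 0

/-- A path from `(l₁, p₁)` and `(l₂, p₂)` to `(l₃, p₃)` is allowed. -/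
def Allowed (ρ₁ ρ₂ ρ₃ : Irrep) : Prop :=
  Triangle ρ₁.l ρ₂.l ρ₃.l ∧ ρ₁.p * ρ₂.p = ρ₃.p

/-- The data of an instance of the `TensorProduct` class: a set of allowed paths, each of which
connects two inputs to an output, and a weight for each path. -/
structure TensorProductClass {n₁ n₂ n₃ : ℕ} (ρ₁ : Fin n₁ → Irrep) (ρ₂ : Fin n₂ → Irrep)
    (ρ₃ : Fin n₃ → Irrep) where
  /-- the paths `(u, v, w)`, from the inputs `u` and `v` to the output `w` -/
  paths : Finset (Fin n₁ × Fin n₂ × Fin n₃)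
  /-- every path satisfies the selection rules -/
  allowed : ∀ q ∈ paths, Allowed (ρ₁ q.1) (ρ₂ q.2.1) (ρ₃ q.2.2)
  /-- the weights of the paths -/
  weight : Fin n₁ → Fin n₂ → Fin n₃ → ℝ

/-- The operation defined by an instance of the `TensorProduct` class: the output number `w` is the
sum over the paths `(u, v, w)` of `weight_{uvw} ∑_{ij} C_{ijk} x_{ui} y_{vj}`. -/
noncomputable def TensorProductClass.eval {n₁ n₂ n₃ : ℕ} {ρ₁ : Fin n₁ → Irrep}
    {ρ₂ : Fin n₂ → Irrep} {ρ₃ : Fin n₃ → Irrep} (T : TensorProductClass ρ₁ ρ₂ ρ₃)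
    (C : Coefficients) (x : Space ρ₁) (y : Space ρ₂) : Space ρ₃ :=
  fun w k => ∑ u, ∑ v, if (u, v, w) ∈ T.paths then
    T.weight u v w * ∑ i, ∑ j, C (ρ₁ u).l (ρ₂ v).l (ρ₃ w).l i j k * x u i * y v j else 0

end E3nn

/-! Everything reduces to rotation-invariant tensors on a product of three irreps: they form a line
when the triangle inequality holds, and vanish otherwise. In orthogonal coordinates such a tensor is
the same thing as an intertwiner from the tensor product of the first two irreps to the third
(`isInvariant_iff_mul`).

Orthogonal coordinates come from the Fischer pairing, for which multiplication by a variable is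
adjoint to differentiation. A linear substitution is then adjoint to the transposed one, so
rotations act by isometries, and a Fischer-orthonormal basis of `Harm l` has orthogonal matrices.
The dimension of `Harm l` is counted by coefficients.

Nonzero invariants (`exists_isInvariant_ne_zero`) are obtained by pairing `p ⊗ q ⊗ r` with a product
of inner products and at most one determinant of three vector variables, of degrees `l₁`, `l₂`,
`l₃`. Powers of complex null linear forms are harmonic, and on them the pairing is, up to
factorials, the value of the invariant polynomial at the three null vectors; suitable vectors make
it nonzero.

Uniqueness (`IsInvariant.proportional`, `IsInvariant.triangle`) is highest-weight theory.
Differentiating along axis rotations and complexifying gives `sl₂`-invariance, and an invariant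
trilinear form is determined by the single number `T(w₁, E^n w₂, v₃)`, where `w` is a lowest and `v`
a highest weight vector and `n + l₃ = l₁ + l₂` (`eq_zero_of_lieInvariant`). If `l₃ > l₁ + l₂` there
is no such `n`; cyclic symmetry gives the other two inequalities.

With `l₃ = 0` uniqueness is Schur's lemma: the Gram matrix of an invariant tensor is scalar, and
rescaling yields Clebsch–Gordan coefficients. Finally, an equivariant map is cut into blocks.
Rotations make each block a multiple of the Clebsch–Gordan tensor or zero, and the inversion, which
acts by the parities, forces the parity rule. -/

namespace E3nn

open MvPolynomial

/-! ### The Fischer pairing and its adjunction formulas. -/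

section Fischer

variable {K : Type*} [CommRing K] {σ τ : Type*} [Fintype σ]

/-- The Fischer pairing `⟨P, Q⟩ = ∑ d, d! P_d Q_d` of polynomials. -/
noncomputable def fischer : MvPolynomial σ K →ₗ[K] MvPolynomial σ K →ₗ[K] K :=
  (basisMonomials σ K).constr K fun d => ((∏ i, (d i).factorial : ℕ) : K) • lcoeff K d

theorem fischer_monomial (d : σ →₀ ℕ) (a : K) (Q : MvPolynomial σ K) :
    fischer (monomial d a) Q = a * ((∏ i, (d i).factorial : ℕ) : K) * coeff d Q := by
  have h : monomial d a = a • basisMonomials σ K d := by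
    simp [coe_basisMonomials, smul_monomial]
  rw [h, map_smul, fischer, Module.Basis.constr_basis]
  simp [lcoeff, mul_assoc]

theorem fischer_C (a : K) (Q : MvPolynomial σ K) :
    fischer (C a) Q = a * coeff 0 Q := by
  rw [C_apply, fischer_monomial]
  simp

theorem fischer_mul_X (P Q : MvPolynomial σ K) (i : σ) :
    fischer (P * X i) Q = fischer P (pderiv i Q) := by
  classical
  induction P using MvPolynomial.induction_on' with
  | add p q hp hq => simp [add_mul, hp, hq]
  | monomial d a =>
    have h : monomial d a * X i = monomial (d + Finsupp.single i 1) a := by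
      rw [X, monomial_mul, mul_one]
    rw [h, fischer_monomial, fischer_monomial, coeff_pderiv]
    have h2 : ∏ j, ((d + Finsupp.single i 1 : σ →₀ ℕ) j).factorial
        = (d i + 1) * ∏ j, (d j).factorial := by
      rw [← Finset.mul_prod_erase _ _ (Finset.mem_univ i),
        ← Finset.mul_prod_erase Finset.univ (fun j => (d j).factorial) (Finset.mem_univ i),
        ← mul_assoc]
      congr 1
      · simp [Nat.factorial_succ]
      · refine Finset.prod_congr rfl fun j hj => ?_
        simp [(Finset.ne_of_mem_erase hj).symm]
    rw [h2]
    push_cast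
    ring

/-- The linear substitution `X t ↦ ∑ s, A s t * X s`. -/
noncomputable def linSubst (A : Matrix σ τ K) : MvPolynomial τ K →ₐ[K] MvPolynomial σ K :=
  aeval fun t => ∑ s, C (A s t) * X s

theorem linSubst_X (A : Matrix σ τ K) (t : τ) : linSubst A (X t) = ∑ s, C (A s t) * X s := by
  simp [linSubst]

theorem linSubst_C (A : Matrix σ τ K) (a : K) : linSubst A (C a) = C a := by
  simp [linSubst]

theorem pderiv_linSubst [Fintype τ] (A : Matrix σ τ K) (s : σ) (h : MvPolynomial τ K) :
    pderiv s (linSubst A h) = ∑ t, C (A s t) * linSubst A (pderiv t h) := by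
  classical
  induction h using MvPolynomial.induction_on with
  | C a => simp [linSubst]
  | add p q hp hq => simp only [map_add, hp, hq, mul_add, Finset.sum_add_distrib]
  | mul_X p n hp =>
    have hX : pderiv s (linSubst A (X n)) = C (A s n) := by
      simp [linSubst, pderiv_X, Pi.single_apply]
    simp only [map_mul, Derivation.leibniz, hp, hX, smul_eq_mul, pderiv_X, map_add, mul_add,
      Finset.sum_add_distrib, Finset.mul_sum]
    congr 1
    · rw [Finset.sum_eq_single n]
      · simp [mul_comm]
      · intro b _ hb
        simp [hb.symm]
      · simp
    · exact Finset.sum_congr rfl fun i _ => by ring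

theorem coeff_zero_linSubst (A : Matrix σ τ K) (P : MvPolynomial τ K) :
    coeff 0 (linSubst A P) = coeff 0 P := by
  change constantCoeff (linSubst A P) = constantCoeff P
  induction P using MvPolynomial.induction_on with
  | C a => simp [linSubst]
  | add p q hp hq => simp only [map_add, hp, hq]
  | mul_X p n hp => simp [linSubst]

/-- Follows from the adjunction of `X i` and `pderiv i` by the chain rule. Rectangular matrices are
allowed because nonvanishing of the invariant form is tested with a 9 × 3 substitution. -/
theorem fischer_linSubst [Fintype τ] (A : Matrix σ τ K) (P : MvPolynomial τ K)
    (Q : MvPolynomial σ K) :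
    fischer (linSubst A P) Q = fischer P (linSubst A.transpose Q) := by
  induction P using MvPolynomial.induction_on generalizing Q with
  | C a => rw [linSubst_C, fischer_C, fischer_C, coeff_zero_linSubst]
  | add p q hp hq => simp only [map_add, LinearMap.add_apply, hp, hq]
  | mul_X p n hp =>
    rw [map_mul, linSubst_X, fischer_mul_X, pderiv_linSubst, Finset.mul_sum, map_sum, map_sum,
      LinearMap.sum_apply]
    refine Finset.sum_congr rfl fun s _ => ?_
    rw [← smul_eq_C_mul, ← smul_eq_C_mul, mul_smul_comm, map_smul, map_smul, LinearMap.smul_apply,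
      fischer_mul_X, hp]
    rfl

theorem fischer_map {L : Type*} [CommRing L] (φ : K →+* L) (P Q : MvPolynomial σ K) :
    fischer (map φ P) (map φ Q) = φ (fischer P Q) := by
  induction P using MvPolynomial.induction_on' with
  | add p q hp hq => simp [hp, hq]
  | monomial d a => simp [map_monomial, fischer_monomial, coeff_map]

end Fischer

/-! ### Symmetry and positivity over the reals. -/

section FischerReal

variable {σ : Type*} [Fintype σ]

theorem fischer_eq_sum (P Q : MvPolynomial σ ℝ) :
    fischer P Q = ∑ d ∈ P.support, ((∏ i, (d i).factorial : ℕ) : ℝ) * (coeff d P * coeff d Q) := by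
  conv_lhs => rw [P.as_sum]
  rw [map_sum, LinearMap.sum_apply]
  refine Finset.sum_congr rfl fun d _ => ?_
  rw [fischer_monomial]
  ring

theorem fischer_comm (P Q : MvPolynomial σ ℝ) : fischer P Q = fischer Q P := by
  induction P using MvPolynomial.induction_on' with
  | add p q hp hq => simp [hp, hq]
  | monomial d a =>
    induction Q using MvPolynomial.induction_on' with
    | add p q hp hq => simp [hp, hq]
    | monomial e b =>
      classical
      simp only [fischer_monomial, coeff_monomial]
      by_cases h : d = e
      · subst h; simp; ring
      · simp [h, Ne.symm h]

theorem fischer_self_nonneg (P : MvPolynomial σ ℝ) : 0 ≤ fischer P P := by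
  rw [fischer_eq_sum]
  exact Finset.sum_nonneg fun d _ => mul_nonneg (Nat.cast_nonneg _) (mul_self_nonneg _)

theorem eq_zero_of_fischer_self_eq_zero {P : MvPolynomial σ ℝ} (h : fischer P P = 0) : P = 0 := by
  rw [fischer_eq_sum, Finset.sum_eq_zero_iff_of_nonneg
    fun d _ => mul_nonneg (Nat.cast_nonneg _) (mul_self_nonneg _)] at h
  by_contra hP
  obtain ⟨d, hd⟩ := support_nonempty.2 hP
  have h1 := h d hd
  rw [mem_support_iff] at hd
  have h2 : ((∏ i, (d i).factorial : ℕ) : ℝ) ≠ 0 :=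
    Nat.cast_ne_zero.2 (Finset.prod_ne_zero_iff.2 fun i _ => Nat.factorial_ne_zero _)
  exact (mul_ne_zero h2 (mul_ne_zero hd hd)) h1

end FischerReal

/-! ### Dimension of the harmonic polynomials and orthogonal coordinates. -/

theorem subst_eq_linSubst (A : Matrix (Fin 3) (Fin 3) ℝ) : subst A = linSubst A := rfl

theorem transpose_mul_self (R : SO3) : R.1.transpose * R.1 = 1 :=
  (Matrix.mem_orthogonalGroup_iff' _ _).1 ((Matrix.mem_specialOrthogonalGroup_iff).1 R.2).1

theorem fischer_subst_subst (R : SO3) (P Q : MvPolynomial (Fin 3) ℝ) :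
    fischer (subst R.1 P) (subst R.1 Q) = fischer P Q := by
  rw [subst_eq_linSubst, fischer_linSubst, ← subst_eq_linSubst, ← subst_eq_linSubst,
    ← AlgHom.comp_apply, ← subst_mul, transpose_mul_self R, subst_one]
  rfl

theorem coeff_laplacian (h : MvPolynomial (Fin 3) ℝ) (d : Fin 3 →₀ ℕ) :
    coeff d (laplacian h) = ∑ i : Fin 3,
      coeff (d + Finsupp.single i 2) h * ((d i + 1) * (d i + 2)) := by
  simp only [laplacian, LinearMap.sum_apply, LinearMap.comp_apply, Derivation.coeFn_coe,
    coeff_sum, coeff_pderiv]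
  refine Finset.sum_congr rfl fun i _ => ?_
  rw [add_assoc, ← Finsupp.single_add]
  simp
  ring

/-- The equation `Δh = 0` at the exponent `e` expresses the coefficient at `e + 2ε₂` through those
at `e + 2ε₀` and `e + 2ε₁`, whose last exponent is smaller by two. Hence a harmonic polynomial is
determined by its terms of degree at most one in the last variable. -/
theorem harm_ext_aux {l : ℕ} {h : MvPolynomial (Fin 3) ℝ} (hh : h ∈ Harm l)
    (low : ∀ d : Fin 3 →₀ ℕ, d.degree = l → d 2 ≤ 1 → coeff d h = 0) (n : ℕ) :
    ∀ d : Fin 3 →₀ ℕ, d 2 = n → coeff d h = 0 := by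
  have hhom : h.IsHomogeneous l := hh.1
  have hlap : laplacian h = 0 := hh.2
  induction n using Nat.strong_induction_on with
  | _ n ih =>
    intro d hd
    by_cases hdeg : d.degree = l
    · by_cases hn : n ≤ 1
      · exact low d hdeg (by omega)
      · have hle : Finsupp.single (2 : Fin 3) 2 ≤ d := by
          rw [Finsupp.single_le_iff]; omega
        obtain ⟨e, rfl⟩ := exists_add_of_le hle
        have he : n = e 2 + 2 := by simp [← hd, add_comm]
        have h1 := coeff_laplacian h e
        rw [hlap, coeff_zero, Fin.sum_univ_three,
          ih (e 2) (by omega) (e + Finsupp.single 0 2) (by simp),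
          ih (e 2) (by omega) (e + Finsupp.single 1 2) (by simp), zero_mul, zero_mul, zero_add,
          zero_add] at h1
        rw [add_comm]
        exact (mul_eq_zero.1 h1.symm).resolve_right (by positivity)
    · exact hhom.coeff_eq_zero hdeg

theorem card_degree_eq (l : ℕ) : Nat.card {d : Fin 3 →₀ ℕ | d.degree = l} = (l + 2).choose 2 := by
  have h : {d : Fin 3 →₀ ℕ | d.degree = l}
      = ((Finset.univ : Finset (Fin 3)).finsuppAntidiag l : Set (Fin 3 →₀ ℕ)) := by
    ext d
    simp [Finset.mem_finsuppAntidiag, Finsupp.degree_eq_sum]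
  rw [h, Nat.card_coe_set_eq, Set.ncard_coe_finset, Finset.card_finsuppAntidiag_nat_eq_choose,
    Finset.card_univ, Fintype.card_fin, ← Nat.choose_symm (by omega)]
  congr 1 <;> omega

theorem homogeneousSubmodule_eq_restrictSupport (l : ℕ) :
    homogeneousSubmodule (Fin 3) ℝ l = restrictSupport ℝ {d | d.degree = l} :=
  homogeneousSubmodule_eq_finsupp_supported _ _ l

theorem finite_degree_eq (l : ℕ) : Finite {d : Fin 3 →₀ ℕ | d.degree = l} :=
  Nat.finite_of_card_ne_zero (by
    rw [card_degree_eq]; exact (Nat.choose_pos (by omega)).ne')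

theorem finrank_homogeneousSubmodule (l : ℕ) :
    Module.finrank ℝ (homogeneousSubmodule (Fin 3) ℝ l) = (l + 2).choose 2 := by
  rw [homogeneousSubmodule_eq_restrictSupport,
    Module.finrank_eq_nat_card_basis (basisRestrictSupport ℝ _), card_degree_eq]

instance (l : ℕ) : Module.Finite ℝ (homogeneousSubmodule (Fin 3) ℝ l) := by
  have := finite_degree_eq l
  rw [homogeneousSubmodule_eq_restrictSupport]
  exact Module.Finite.of_basis (basisRestrictSupport ℝ _)

instance (l : ℕ) : Module.Finite ℝ (Harm l) :=
  Submodule.finiteDimensional_of_le (inf_le_left : Harm l ≤ homogeneousSubmodule (Fin 3) ℝ l)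

theorem finrank_harm_le (l : ℕ) : Module.finrank ℝ (Harm l) ≤ 2 * l + 1 := by
  -- The `(l + 1) + l` exponents of degree `l` whose last entry is 0 or 1. For `l = 0` the second
  -- family is empty, so the truncated `l - 1` does no harm.
  let e : Fin (l + 1) ⊕ Fin l → (Fin 3 →₀ ℕ) :=
    Sum.elim (fun a => Finsupp.equivFunOnFinite.symm ![a, l - a, 0])
      (fun a => Finsupp.equivFunOnFinite.symm ![a, l - 1 - a, 1])
  let φ : Harm l →ₗ[ℝ] (Fin (l + 1) ⊕ Fin l → ℝ) :=
    (LinearMap.pi fun s => lcoeff ℝ (e s)) ∘ₗ (Harm l).subtype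
  have hφ : Function.Injective φ := by
    rw [injective_iff_map_eq_zero]
    intro h h0
    have h1 : ∀ s, coeff (e s) h.1 = 0 := fun s => congrFun h0 s
    apply Subtype.ext
    ext d
    refine harm_ext_aux h.2 (fun d hd hd2 => ?_) (d 2) d rfl
    rw [Finsupp.degree_eq_sum, Fin.sum_univ_three] at hd
    interval_cases h2 : d 2
    · have : d = e (Sum.inl ⟨d 0, by omega⟩) := by
        ext i
        fin_cases i <;> simp [e, h2]
        omega
      rw [this]; exact h1 _
    · have : d = e (Sum.inr ⟨d 0, by omega⟩) := by
        ext i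
        fin_cases i <;> simp [e, h2]
        omega
      rw [this]; exact h1 _
  refine (LinearMap.finrank_le_finrank_of_injective hφ).trans ?_
  simp
  omega

/-- Rank–nullity: the Laplacian imposes at most `l.choose 2` conditions, one for each monomial of
degree `l - 2`, on a space of dimension `(l + 2).choose 2`. -/
theorem le_finrank_harm (l : ℕ) : 2 * l + 1 ≤ Module.finrank ℝ (Harm l) := by
  let S : Set (Fin 3 →₀ ℕ) := {d | d.degree + 2 = l}
  have hS : Finite S ∧ Nat.card S = l.choose 2 := by
    by_cases hl : 2 ≤ l
    · obtain ⟨m, rfl⟩ := Nat.exists_eq_add_of_le' hl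
      have : S = {d | d.degree = m} := by ext d; simp [S]
      rw [this]
      exact ⟨finite_degree_eq m, card_degree_eq m⟩
    · have : S = ∅ := by ext d; simp [S]; omega
      rw [this, Nat.choose_eq_zero_of_lt (by omega)]
      exact ⟨inferInstance, by simp⟩
  have := hS.1
  have := Fintype.ofFinite S
  let φ : homogeneousSubmodule (Fin 3) ℝ l →ₗ[ℝ] (S → ℝ) :=
    (LinearMap.pi fun s : S => lcoeff ℝ s.1) ∘ₗ laplacian ∘ₗ Submodule.subtype _
  have hker : (LinearMap.ker φ).map (Submodule.subtype _) ≤ Harm l := by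
    rintro _ ⟨h, hh, rfl⟩
    refine ⟨h.2, ?_⟩
    have h1 : ∀ d : S, coeff d.1 (laplacian h.1) = 0 := fun d => congrFun hh d
    change laplacian h.1 = 0
    ext d
    by_cases hd : d.degree + 2 = l
    · exact h1 ⟨d, hd⟩
    · rw [coeff_laplacian, coeff_zero]
      refine Finset.sum_eq_zero fun i _ => ?_
      rw [IsHomogeneous.coeff_eq_zero h.2 (by simpa using hd), zero_mul]
  have h1 := Submodule.finrank_mono hker
  rw [Submodule.finrank_map_subtype_eq] at h1
  have h2 := LinearMap.finrank_range_add_finrank_ker φ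
  rw [finrank_homogeneousSubmodule] at h2
  have h3 := Submodule.finrank_le (LinearMap.range φ)
  rw [Module.finrank_fintype_fun_eq_card, ← Nat.card_eq_fintype_card, hS.2] at h3
  have h4 : (l + 2).choose 2 = l.choose 2 + (2 * l + 1) := by
    simp [Nat.choose_succ_succ]
    omega
  omega

theorem finrank_harm (l : ℕ) : Module.finrank ℝ (Harm l) = 2 * l + 1 :=
  le_antisymm (finrank_harm_le l) (le_finrank_harm l)

theorem exists_fischer_orthonormal (l : ℕ) :
    ∃ b : Module.Basis (Fin (2 * l + 1)) ℝ (Harm l),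
      ∀ i j, fischer (b i).1 (b j).1 = if i = j then 1 else 0 := by
  let core : InnerProductSpace.Core ℝ (Harm l) :=
    { inner := fun p q => fischer p.1 q.1
      conj_inner_symm := fun p q => fischer_comm _ _
      re_inner_nonneg := fun p => fischer_self_nonneg _
      add_left := fun p q r => by simp
      smul_left := fun p q r => by simp
      definite := fun p hp => Subtype.ext (eq_zero_of_fischer_self_eq_zero hp) }
  let : NormedAddCommGroup (Harm l) := core.toNormedAddCommGroup
  let : InnerProductSpace ℝ (Harm l) := InnerProductSpace.ofCore core.toCore
  let e := (stdOrthonormalBasis ℝ (Harm l)).reindex (finCongr (finrank_harm l))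
  exact ⟨e.toBasis, fun i j => by
    rw [OrthonormalBasis.coe_toBasis]
    exact orthonormal_iff_ite.1 e.orthonormal i j⟩

theorem subst_basis (b : Coordinates) (l : ℕ) (R : SO3) (j : Fin (2 * l + 1)) :
    subst R.1 (b l j).1 = ∑ k, D b l R k j • (b l k).1 := by
  have := congrArg Subtype.val ((b l).sum_repr (harmRep l R (b l j)))
  rw [Submodule.coe_sum] at this
  refine this.symm.trans (Finset.sum_congr rfl fun k _ => ?_)
  simp [D, LinearMap.toMatrix_apply]

theorem exists_isOrthogonal : ∃ b : Coordinates, b.IsOrthogonal := by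
  choose b hb using exists_fischer_orthonormal
  refine ⟨b, fun l R => ?_⟩
  rw [Matrix.mem_orthogonalGroup_iff']
  ext i j
  have h2 := fischer_subst_subst R (b l i).1 (b l j).1
  rw [subst_basis, subst_basis, hb] at h2
  simp only [map_sum, LinearMap.sum_apply, map_smul, LinearMap.smul_apply, hb] at h2
  simp only [smul_eq_mul, mul_ite, mul_one, mul_zero, Finset.sum_ite_eq',
    Finset.mem_univ, if_true] at h2
  rw [Matrix.one_apply, ← h2, Matrix.mul_apply]
  exact Finset.sum_congr rfl fun k _ => by simp [mul_comm]

/-! ### Harmonic powers of complex null linear forms, in real and imaginary parts. -/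

section NullPowers

/-- The linear form with coefficient vector `a`. -/
noncomputable def linForm (a : Fin 3 → ℝ) : MvPolynomial (Fin 3) ℝ := ∑ i, C (a i) * X i

/-- Real and imaginary part of the `n`-th power of the linear form with coefficients `a + c i`. -/
noncomputable def powParts (a c : Fin 3 → ℝ) : ℕ → MvPolynomial (Fin 3) ℝ × MvPolynomial (Fin 3) ℝ
  | 0 => (1, 0)
  | n + 1 => (linForm a * (powParts a c n).1 - linForm c * (powParts a c n).2,
      linForm a * (powParts a c n).2 + linForm c * (powParts a c n).1)

variable (a c : Fin 3 → ℝ)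

/-- Real and imaginary parts of `δ(Lⁿ⁺¹) = (n + 1) δ(L) Lⁿ` for the complex linear form `L`. -/
theorem derivation_powParts (δ : Derivation ℝ (MvPolynomial (Fin 3) ℝ) (MvPolynomial (Fin 3) ℝ))
    (n : ℕ) :
    δ (powParts a c (n + 1)).1 = (n + 1 : MvPolynomial (Fin 3) ℝ) *
      (δ (linForm a) * (powParts a c n).1 - δ (linForm c) * (powParts a c n).2) ∧
    δ (powParts a c (n + 1)).2 = (n + 1 : MvPolynomial (Fin 3) ℝ) *
      (δ (linForm a) * (powParts a c n).2 + δ (linForm c) * (powParts a c n).1) := by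
  induction n with
  | zero => simp [powParts]
  | succ n ih =>
    rw [powParts, map_sub, map_add]
    simp only [Derivation.leibniz, smul_eq_mul, ih.1, ih.2]
    simp only [powParts]
    push_cast
    constructor <;> ring

theorem pderiv_linForm (i : Fin 3) : pderiv i (linForm a) = C (a i) := by
  simp [linForm, pderiv_X, Pi.single_apply]

theorem isHomogeneous_linForm : (linForm a).IsHomogeneous 1 :=
  IsHomogeneous.sum _ _ _ fun _ _ => isHomogeneous_C_mul_X _ _

theorem isHomogeneous_powParts (n : ℕ) :
    (powParts a c n).1.IsHomogeneous n ∧ (powParts a c n).2.IsHomogeneous n := by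
  induction n with
  | zero => exact ⟨isHomogeneous_one _ _, isHomogeneous_zero _ _ _⟩
  | succ n ih =>
    have ha := isHomogeneous_linForm a
    have hc := isHomogeneous_linForm c
    rw [powParts, add_comm n 1]
    exact ⟨(ha.mul ih.1).sub (hc.mul ih.2), (ha.mul ih.2).add (hc.mul ih.1)⟩

/-- With `u = a + i c`, the Laplacian of `(u·x)^n` is `n (n - 1) (u·u) (u·x)^(n-2)`, and the two
hypotheses say exactly that `u·u = 0`. -/
theorem laplacian_powParts (h₁ : ∑ i, a i * a i = ∑ i, c i * c i) (h₂ : ∑ i, a i * c i = 0)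
    (n : ℕ) :
    laplacian (powParts a c n).1 = 0 ∧ laplacian (powParts a c n).2 = 0 := by
  match n with
  | 0 => simp [powParts, laplacian]
  | 1 => simp [powParts, laplacian, pderiv_linForm]
  | n + 2 =>
    have h₁' := congrArg (C : ℝ → MvPolynomial (Fin 3) ℝ) h₁
    have h₂' := congrArg (C : ℝ → MvPolynomial (Fin 3) ℝ) h₂
    simp only [Fin.sum_univ_three, map_add, map_mul, map_zero] at h₁' h₂'
    have key : ∀ (i : Fin 3),
        pderiv i (pderiv i (powParts a c (n + 2)).1) =
          ((n : MvPolynomial (Fin 3) ℝ) + 2) * ((n : MvPolynomial (Fin 3) ℝ) + 1) *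
            ((C (a i) * C (a i) - C (c i) * C (c i)) * (powParts a c n).1
              - 2 * (C (a i) * C (c i)) * (powParts a c n).2) ∧
        pderiv i (pderiv i (powParts a c (n + 2)).2) =
          ((n : MvPolynomial (Fin 3) ℝ) + 2) * ((n : MvPolynomial (Fin 3) ℝ) + 1) *
            ((C (a i) * C (a i) - C (c i) * C (c i)) * (powParts a c n).2
              + 2 * (C (a i) * C (c i)) * (powParts a c n).1) := by
      intro i
      have hn : ((n + 1 : ℕ) : MvPolynomial (Fin 3) ℝ) + 1 = C ((n + 2 : ℕ) : ℝ) := by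
        rw [map_natCast]; push_cast; ring
      rw [(derivation_powParts a c (pderiv i) (n + 1)).1,
        (derivation_powParts a c (pderiv i) (n + 1)).2, hn]
      simp only [pderiv_linForm, pderiv_C_mul, map_sub, map_add,
        (derivation_powParts a c (pderiv i) n).1, (derivation_powParts a c (pderiv i) n).2]
      simp only [map_natCast]
      push_cast
      constructor <;> ring
    simp only [laplacian, Fin.sum_univ_three, LinearMap.add_apply, LinearMap.comp_apply,
      Derivation.coeFn_coe, key]
    constructor
    · linear_combination ((n : MvPolynomial (Fin 3) ℝ) + 2) * ((n : MvPolynomial (Fin 3) ℝ) + 1) *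
        ((powParts a c n).1 * h₁' - 2 * (powParts a c n).2 * h₂')
    · linear_combination ((n : MvPolynomial (Fin 3) ℝ) + 2) * ((n : MvPolynomial (Fin 3) ℝ) + 1) *
        ((powParts a c n).2 * h₁' + 2 * (powParts a c n).1 * h₂')

theorem powParts_mem_harm (h₁ : ∑ i, a i * a i = ∑ i, c i * c i) (h₂ : ∑ i, a i * c i = 0)
    (n : ℕ) : (powParts a c n).1 ∈ Harm n ∧ (powParts a c n).2 ∈ Harm n :=
  ⟨⟨(isHomogeneous_powParts a c n).1, (laplacian_powParts a c h₁ h₂ n).1⟩,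
    ⟨(isHomogeneous_powParts a c n).2, (laplacian_powParts a c h₁ h₂ n).2⟩⟩

theorem map_powParts (n : ℕ) :
    map Complex.ofRealHom (powParts a c n).1
        + C Complex.I * map Complex.ofRealHom (powParts a c n).2
      = (∑ i, C ((a i : ℂ) + Complex.I * c i) * X i) ^ n := by
  have hl : (∑ i, C ((a i : ℂ) + Complex.I * c i) * X i : MvPolynomial (Fin 3) ℂ)
      = map Complex.ofRealHom (linForm a) + C Complex.I * map Complex.ofRealHom (linForm c) := by
    simp only [linForm, map_sum, map_mul, map_C, map_X, Finset.mul_sum, ← Finset.sum_add_distrib]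
    refine Finset.sum_congr rfl fun i _ => ?_
    simp
    ring
  have hI : (C Complex.I * C Complex.I : MvPolynomial (Fin 3) ℂ) = -1 := by
    rw [← C_mul, Complex.I_mul_I]; simp
  induction n with
  | zero => simp [powParts]
  | succ n ih =>
    rw [pow_succ, ← ih, hl]
    simp only [powParts, map_sub, map_add, map_mul]
    linear_combination (-(map Complex.ofRealHom (linForm c) *
      map Complex.ofRealHom (powParts a c n).2)) * hI

end NullPowers

/-! ### Invariants of three vectors and nonvanishing of their pairing with harmonics. -/

section InvariantForm

variable {K : Type*} [CommRing K]

/-- The inner product of the vector variables number `s` and `t`. -/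
noncomputable def dotPoly (K : Type*) [CommRing K] (s t : Fin 3) :
    MvPolynomial (Fin 3 × Fin 3) K :=
  ∑ i, X (s, i) * X (t, i)

/-- The determinant of three vector variables. -/
noncomputable def detPoly (K : Type*) [CommRing K] : MvPolynomial (Fin 3 × Fin 3) K :=
  (Matrix.of fun s i => X (s, i)).det

/-- An invariant of three vector variables. -/
noncomputable def invPoly (K : Type*) [CommRing K] (k₁ k₂ k₃ k₄ : ℕ) :
    MvPolynomial (Fin 3 × Fin 3) K :=
  dotPoly K 0 1 ^ k₁ * dotPoly K 1 2 ^ k₂ * dotPoly K 0 2 ^ k₃ * detPoly K ^ k₄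

theorem map_invPoly {L : Type*} [CommRing L] (φ : K →+* L) (k₁ k₂ k₃ k₄ : ℕ) :
    map φ (invPoly K k₁ k₂ k₃ k₄) = invPoly L k₁ k₂ k₃ k₄ := by
  have h : map φ (detPoly K) = detPoly L := by
    rw [detPoly, RingHom.map_det]
    congr 1
    ext1 s i
    simp
  simp [invPoly, dotPoly, h]

/-- The simultaneous linear transformation of three vectors. -/
def diagonalMatrix (A : Matrix (Fin 3) (Fin 3) K) : Matrix (Fin 3 × Fin 3) (Fin 3 × Fin 3) K :=
  Matrix.of fun x y => if x.1 = y.1 then A x.2 y.2 else 0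

theorem linSubst_diagonalMatrix_X (A : Matrix (Fin 3) (Fin 3) K) (t i : Fin 3) :
    linSubst (diagonalMatrix A) (X (t, i)) = ∑ j, C (A j i) * X (t, j) := by
  rw [linSubst_X, Fintype.sum_prod_type, Finset.sum_eq_single t]
  · simp [diagonalMatrix]
  · intro s _ hs
    simp [diagonalMatrix, hs]
  · simp

theorem linSubst_diagonalMatrix_rename (A : Matrix (Fin 3) (Fin 3) K) (t : Fin 3)
    (p : MvPolynomial (Fin 3) K) :
    linSubst (diagonalMatrix A) (rename (Prod.mk t) p) = rename (Prod.mk t) (linSubst A p) := by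
  rw [← AlgHom.comp_apply, ← AlgHom.comp_apply]
  congr 1
  ext1 i
  simp only [AlgHom.comp_apply, rename_X, linSubst_diagonalMatrix_X]
  simp [linSubst_X]

theorem linSubst_diagonalMatrix_invPoly (A : Matrix (Fin 3) (Fin 3) K)
    (hA : A * A.transpose = 1) (hdet : A.det = 1) (k₁ k₂ k₃ k₄ : ℕ) :
    linSubst (diagonalMatrix A) (invPoly K k₁ k₂ k₃ k₄) = invPoly K k₁ k₂ k₃ k₄ := by
  have hdot : ∀ s t, linSubst (diagonalMatrix A) (dotPoly K s t) = dotPoly K s t := by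
    intro s t
    have h : ∀ j k, ∑ i, A j i * A k i = if j = k then 1 else 0 := by
      intro j k
      rw [← Matrix.one_apply, ← hA, Matrix.mul_apply]
      rfl
    simp only [dotPoly, map_sum, map_mul, linSubst_diagonalMatrix_X]
    calc _ = ∑ j, ∑ k, C (∑ i, A j i * A k i) * (X (s, j) * X (t, k)) := by
          simp only [Finset.sum_mul_sum]
          simp only [map_sum, Finset.sum_mul, map_mul]
          rw [Finset.sum_comm]
          refine Finset.sum_congr rfl fun j _ => ?_
          rw [Finset.sum_comm]
          refine Finset.sum_congr rfl fun k _ => Finset.sum_congr rfl fun i _ => ?_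
          ring
      _ = _ := by simp [h, apply_ite C]
  have hd : linSubst (diagonalMatrix A) (detPoly K) = detPoly K := by
    have : (linSubst (diagonalMatrix A)).mapMatrix (Matrix.of fun s i => X (s, i))
        = (Matrix.of fun s i => X (s, i) : Matrix (Fin 3) (Fin 3) (MvPolynomial (Fin 3 × Fin 3) K))
          * A.map C := by
      ext1 s i
      simp [linSubst_diagonalMatrix_X, Matrix.mul_apply, mul_comm]
    rw [detPoly, AlgHom.map_det, this, Matrix.det_mul]
    have h2 : (A.map C).det = (C A.det : MvPolynomial (Fin 3 × Fin 3) K) :=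
      (RingHom.map_det C A).symm
    rw [h2, hdet, map_one, mul_one]
  simp [invPoly, hdot, hd]

/-- Product of polynomials in three separate vector variables. -/
noncomputable def prodPoly (p q r : MvPolynomial (Fin 3) K) : MvPolynomial (Fin 3 × Fin 3) K :=
  rename (Prod.mk 0) p * rename (Prod.mk 1) q * rename (Prod.mk 2) r

theorem fischer_prodPoly_subst (R : SO3) (p q r : MvPolynomial (Fin 3) ℝ) (k₁ k₂ k₃ k₄ : ℕ) :
    fischer (prodPoly (subst R.1 p) (subst R.1 q) (subst R.1 r)) (invPoly ℝ k₁ k₂ k₃ k₄)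
      = fischer (prodPoly p q r) (invPoly ℝ k₁ k₂ k₃ k₄) := by
  have h : prodPoly (subst R.1 p) (subst R.1 q) (subst R.1 r)
      = linSubst (diagonalMatrix R.1) (prodPoly p q r) := by
    simp only [prodPoly, map_mul, linSubst_diagonalMatrix_rename, subst_eq_linSubst]
  have ht : (diagonalMatrix R.1).transpose = diagonalMatrix R.1.transpose := by
    ext x y
    simp [diagonalMatrix, eq_comm]
  rw [h, fischer_linSubst, ht, linSubst_diagonalMatrix_invPoly]
  · rw [Matrix.transpose_transpose, transpose_mul_self]
  · rw [Matrix.det_transpose]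
    exact ((Matrix.mem_specialOrthogonalGroup_iff).1 R.2).2

/-- The product of powers of linear forms is a monomial in three variables substituted through `U`.
By adjunction the substitution moves to the invariant, replacing vector number `t` by `X t` times
row `t` of `u`; this gives the value of the invariant at `u` times the same monomial, whose Fischer
norm is the product of factorials. -/
theorem fischer_prodPoly_pow (u : Matrix (Fin 3) (Fin 3) K) (k₁ k₂ k₃ k₄ : ℕ) :
    fischer (prodPoly ((∑ i, C (u 0 i) * X i) ^ (k₁ + k₃ + k₄))
        ((∑ i, C (u 1 i) * X i) ^ (k₁ + k₂ + k₄)) ((∑ i, C (u 2 i) * X i) ^ (k₂ + k₃ + k₄)))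
      (invPoly K k₁ k₂ k₃ k₄)
      = (((k₁ + k₃ + k₄).factorial * (k₁ + k₂ + k₄).factorial * (k₂ + k₃ + k₄).factorial : ℕ) : K)
        * ((∑ i, u 0 i * u 1 i) ^ k₁ * (∑ i, u 1 i * u 2 i) ^ k₂ * (∑ i, u 0 i * u 2 i) ^ k₃
          * u.det ^ k₄) := by
  let U : Matrix (Fin 3 × Fin 3) (Fin 3) K := Matrix.of fun x t => if x.1 = t then u x.1 x.2 else 0
  have hX : ∀ t, linSubst U (X t) = rename (Prod.mk t) (∑ i, C (u t i) * X i) := by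
    intro t
    rw [linSubst_X, Fintype.sum_prod_type, Finset.sum_eq_single t]
    · simp [U]
    · intro s _ hs
      simp [U, hs]
    · simp
  have hY : ∀ x, linSubst U.transpose (X x) = C (u x.1 x.2) * X x.1 := by
    intro x
    rw [linSubst_X, Finset.sum_eq_single x.1]
    · simp [U]
    · intro s _ hs
      simp [U, hs.symm]
    · simp
  have h1 : prodPoly ((∑ i, C (u 0 i) * X i) ^ (k₁ + k₃ + k₄))
        ((∑ i, C (u 1 i) * X i) ^ (k₁ + k₂ + k₄)) ((∑ i, C (u 2 i) * X i) ^ (k₂ + k₃ + k₄))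
      = linSubst U (X 0 ^ (k₁ + k₃ + k₄) * X 1 ^ (k₁ + k₂ + k₄) * X 2 ^ (k₂ + k₃ + k₄)) := by
    simp only [prodPoly, map_mul, map_pow, hX]
  have hdot : ∀ s t, linSubst U.transpose (dotPoly K s t)
      = C (∑ i, u s i * u t i) * (X s * X t) := by
    intro s t
    simp only [dotPoly, map_sum, map_mul, hY, Finset.sum_mul]
    exact Finset.sum_congr rfl fun i _ => by ring
  have hd : linSubst U.transpose (detPoly K) = C u.det * (X 0 * X 1 * X 2) := by
    have : (linSubst U.transpose).mapMatrix (Matrix.of fun s i => X (s, i))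
        = Matrix.diagonal X * u.map C := by
      ext1 s i
      simp [hY, mul_comm]
    rw [detPoly, AlgHom.map_det, this, Matrix.det_mul, Matrix.det_diagonal, Fin.prod_univ_three]
    have h2 : (u.map C).det = (C u.det : MvPolynomial (Fin 3) K) := (RingHom.map_det C u).symm
    rw [h2, mul_comm]
  have h2 : linSubst U.transpose (invPoly K k₁ k₂ k₃ k₄)
      = C ((∑ i, u 0 i * u 1 i) ^ k₁ * (∑ i, u 1 i * u 2 i) ^ k₂ * (∑ i, u 0 i * u 2 i) ^ k₃
          * u.det ^ k₄) *
        (X 0 ^ (k₁ + k₃ + k₄) * X 1 ^ (k₁ + k₂ + k₄) * X 2 ^ (k₂ + k₃ + k₄)) := by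
    simp only [invPoly, map_mul, map_pow, hdot, hd]
    ring
  have h3 : (X 0 ^ (k₁ + k₃ + k₄) * X 1 ^ (k₁ + k₂ + k₄) * X 2 ^ (k₂ + k₃ + k₄) :
      MvPolynomial (Fin 3) K) = monomial (Finsupp.single 0 (k₁ + k₃ + k₄) +
        Finsupp.single 1 (k₁ + k₂ + k₄) + Finsupp.single 2 (k₂ + k₃ + k₄)) 1 := by
    simp [X_pow_eq_monomial, monomial_mul]
  rw [h1, fischer_linSubst, h2, h3, fischer_monomial, coeff_C_mul, coeff_monomial, if_pos rfl,
    Fin.prod_univ_three]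
  simp

theorem exists_harm_fischer_ne_zero (k₁ k₂ k₃ k₄ : ℕ) :
    ∃ p ∈ Harm (k₁ + k₃ + k₄), ∃ q ∈ Harm (k₁ + k₂ + k₄), ∃ r ∈ Harm (k₂ + k₃ + k₄),
      fischer (prodPoly p q r) (invPoly ℝ k₁ k₂ k₃ k₄) ≠ 0 := by
  by_contra! H
  -- Three null vectors with all pairwise products (`2`, `-i`, `i`) and the determinant (`2`)
  -- nonzero, so that every choice of exponents is covered.
  let u : Matrix (Fin 3) (Fin 3) ℂ := !![1, Complex.I, 0; 1, -Complex.I, 0; 0, 1, Complex.I]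
  let a : Matrix (Fin 3) (Fin 3) ℝ := !![1, 0, 0; 1, 0, 0; 0, 1, 0]
  let c : Matrix (Fin 3) (Fin 3) ℝ := !![0, 1, 0; 0, -1, 0; 0, 0, 1]
  have hu : ∀ s i, u s i = (a s i : ℂ) + Complex.I * c s i := by
    intro s i
    fin_cases s <;> fin_cases i <;> simp [u, a, c]
  have hac : ∀ s, ∑ i, a s i * a s i = ∑ i, c s i * c s i ∧ ∑ i, a s i * c s i = 0 := by
    intro s
    fin_cases s <;> simp [a, c, Fin.sum_univ_three]
  have hpow : ∀ s n, (∑ i, C (u s i) * X i : MvPolynomial (Fin 3) ℂ) ^ n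
      = map Complex.ofRealHom (powParts (a s) (c s) n).1
        + C Complex.I * map Complex.ofRealHom (powParts (a s) (c s) n).2 := by
    intro s n
    simp only [map_powParts, hu]
  have hmem := fun s => powParts_mem_harm (a s) (c s) (hac s).1 (hac s).2
  have hzero : ∀ p ∈ Harm (k₁ + k₃ + k₄), ∀ q ∈ Harm (k₁ + k₂ + k₄), ∀ r ∈ Harm (k₂ + k₃ + k₄),
      fischer (prodPoly (map Complex.ofRealHom p) (map Complex.ofRealHom q)
        (map Complex.ofRealHom r)) (invPoly ℂ k₁ k₂ k₃ k₄) = 0 := by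
    intro p hp q hq r hr
    have : prodPoly (map Complex.ofRealHom p) (map Complex.ofRealHom q) (map Complex.ofRealHom r)
        = map Complex.ofRealHom (prodPoly p q r) := by
      simp [prodPoly, map_rename]
    rw [this, ← map_invPoly Complex.ofRealHom, fischer_map, H p hp q hq r hr, map_zero]
  have h := fischer_prodPoly_pow u k₁ k₂ k₃ k₄
  -- By trilinearity the complex pairing is a combination of eight pairings of real harmonic
  -- polynomials, all zero under the assumption being refuted.
  have hexp : ∀ p p' q q' r r' : MvPolynomial (Fin 3) ℂ,
      prodPoly (p + C Complex.I * p') (q + C Complex.I * q') (r + C Complex.I * r')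
      = prodPoly p q r + Complex.I • prodPoly p' q r + Complex.I • prodPoly p q' r
        + Complex.I • prodPoly p q r' + (Complex.I * Complex.I) • prodPoly p' q' r
        + (Complex.I * Complex.I) • prodPoly p' q r' + (Complex.I * Complex.I) • prodPoly p q' r'
        + (Complex.I * Complex.I * Complex.I) • prodPoly p' q' r' := by
    intro p p' q q' r r'
    simp only [prodPoly, map_add, map_mul, rename_C, smul_eq_C_mul]
    ring
  rw [hpow, hpow, hpow, hexp] at h
  simp only [map_add, map_smul, LinearMap.add_apply, LinearMap.smul_apply,
    hzero _ (hmem 0 _).1 _ (hmem 1 _).1 _ (hmem 2 _).1,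
    hzero _ (hmem 0 _).1 _ (hmem 1 _).1 _ (hmem 2 _).2,
    hzero _ (hmem 0 _).1 _ (hmem 1 _).2 _ (hmem 2 _).1,
    hzero _ (hmem 0 _).1 _ (hmem 1 _).2 _ (hmem 2 _).2,
    hzero _ (hmem 0 _).2 _ (hmem 1 _).1 _ (hmem 2 _).1,
    hzero _ (hmem 0 _).2 _ (hmem 1 _).1 _ (hmem 2 _).2,
    hzero _ (hmem 0 _).2 _ (hmem 1 _).2 _ (hmem 2 _).1,
    hzero _ (hmem 0 _).2 _ (hmem 1 _).2 _ (hmem 2 _).2, smul_zero, add_zero] at h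
  refine mul_ne_zero (Nat.cast_ne_zero.2 ?_) ?_ h.symm
  · exact mul_ne_zero (mul_ne_zero (Nat.factorial_ne_zero _) (Nat.factorial_ne_zero _))
      (Nat.factorial_ne_zero _)
  · refine mul_ne_zero (mul_ne_zero (mul_ne_zero (pow_ne_zero _ ?_) (pow_ne_zero _ ?_))
      (pow_ne_zero _ ?_)) (pow_ne_zero _ ?_)
    · simp [u, Fin.sum_univ_three]
    · simp [u, Fin.sum_univ_three]
    · simp [u, Fin.sum_univ_three]
    · rw [Matrix.det_fin_three]
      simp [u]

end InvariantForm

/-! ### Nonzero invariant tensors for every triangle. -/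

section Coefficients

/-- The invariance of a tensor under rotations. -/
def IsInvariant (b : Coordinates) (l₁ l₂ l₃ : ℕ)
    (C : Fin (2 * l₁ + 1) → Fin (2 * l₂ + 1) → Fin (2 * l₃ + 1) → ℝ) : Prop :=
  ∀ (R : SO3) l m n,
    C l m n = ∑ i, ∑ j, ∑ k, C i j k * D b l₁ R i l * D b l₂ R j m * D b l₃ R k n

/-- The equations give `l₁ + l₂ - l₃ = 2 k₁ + k₄` and its analogues, so `k₄` must have the parity of
`l₁ + l₂ + l₃`; one determinant factor suffices to correct an odd sum. -/
theorem Triangle.exists_eq_add {l₁ l₂ l₃ : ℕ} (h : Triangle l₁ l₂ l₃) :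
    ∃ k₁ k₂ k₃ k₄ : ℕ, l₁ = k₁ + k₃ + k₄ ∧ l₂ = k₁ + k₂ + k₄ ∧ l₃ = k₂ + k₃ + k₄ := by
  obtain ⟨h1, h2⟩ := h
  rw [abs_le] at h1
  exact ⟨(l₁ + l₂ - l₃) / 2, (l₂ + l₃ - l₁) / 2, (l₁ + l₃ - l₂) / 2, (l₁ + l₂ + l₃) % 2,
    by omega, by omega, by omega⟩

/-- A trilinear form on polynomials. -/
noncomputable def prodForm (F : MvPolynomial (Fin 3 × Fin 3) ℝ) :
    MvPolynomial (Fin 3) ℝ →ₗ[ℝ] MvPolynomial (Fin 3) ℝ →ₗ[ℝ] MvPolynomial (Fin 3) ℝ →ₗ[ℝ] ℝ :=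
  LinearMap.mk₂ ℝ (fun p q => (fischer.flip F) ∘ₗ
      LinearMap.mulLeft ℝ (rename (Prod.mk 0) p * rename (Prod.mk 1) q) ∘ₗ
      (rename (Prod.mk 2)).toLinearMap)
    (fun p p' q => LinearMap.ext fun r => by simp [add_mul, mul_assoc])
    (fun c p q => LinearMap.ext fun r => by simp [mul_assoc])
    (fun p q q' => LinearMap.ext fun r => by simp [add_mul, mul_add, mul_assoc])
    (fun c p q => LinearMap.ext fun r => by simp [mul_assoc])

theorem prodForm_apply (F : MvPolynomial (Fin 3 × Fin 3) ℝ) (p q r : MvPolynomial (Fin 3) ℝ) :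
    prodForm F p q r = fischer (prodPoly p q r) F := rfl

theorem trilinear_sum {𝕜 : Type*} [CommRing 𝕜] {M₁ M₂ M₃ : Type*}
    [AddCommGroup M₁] [AddCommGroup M₂] [AddCommGroup M₃]
    [Module 𝕜 M₁] [Module 𝕜 M₂] [Module 𝕜 M₃] (T : M₁ →ₗ[𝕜] M₂ →ₗ[𝕜] M₃ →ₗ[𝕜] 𝕜)
    {ι₁ ι₂ ι₃ : Type*} [Fintype ι₁] [Fintype ι₂] [Fintype ι₃] (a : ι₁ → 𝕜) (b : ι₂ → 𝕜)
    (c : ι₃ → 𝕜) (x : ι₁ → M₁) (y : ι₂ → M₂) (z : ι₃ → M₃) :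
    T (∑ i, a i • x i) (∑ j, b j • y j) (∑ k, c k • z k)
      = ∑ i, ∑ j, ∑ k, T (x i) (y j) (z k) * a i * b j * c k := by
  rw [map_sum T, LinearMap.sum_apply, LinearMap.sum_apply]
  refine Finset.sum_congr rfl fun i _ => ?_
  rw [map_sum (T (a i • x i)), LinearMap.sum_apply]
  refine Finset.sum_congr rfl fun j _ => ?_
  rw [map_sum]
  refine Finset.sum_congr rfl fun k _ => ?_
  simp only [map_smul, LinearMap.smul_apply, smul_eq_mul]
  ring

theorem exists_isInvariant_ne_zero (b : Coordinates) {l₁ l₂ l₃ : ℕ} (h : Triangle l₁ l₂ l₃) :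
    ∃ C, IsInvariant b l₁ l₂ l₃ C ∧ C ≠ 0 := by
  obtain ⟨k₁, k₂, k₃, k₄, rfl, rfl, rfl⟩ := h.exists_eq_add
  let F := invPoly ℝ k₁ k₂ k₃ k₄
  refine ⟨fun i j k => prodForm F (b _ i).1 (b _ j).1 (b _ k).1, ?_, ?_⟩
  · intro R l m n
    have h1 := fischer_prodPoly_subst R (b _ l).1 (b _ m).1 (b _ n).1 k₁ k₂ k₃ k₄
    rw [← prodForm_apply, ← prodForm_apply, subst_basis, subst_basis, subst_basis,
      trilinear_sum] at h1
    exact h1.symm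
  · intro h0
    obtain ⟨p, hp, q, hq, r, hr, hne⟩ := exists_harm_fischer_ne_zero k₁ k₂ k₃ k₄
    apply hne
    have hb : ∀ {l : ℕ} {p : MvPolynomial (Fin 3) ℝ} (hp : p ∈ Harm l),
        p = ∑ i, (b l).repr ⟨p, hp⟩ i • (b l i).1 := by
      intro l p hp
      have := congrArg Subtype.val ((b l).sum_repr ⟨p, hp⟩)
      rw [Submodule.coe_sum] at this
      exact this.symm
    have h0' : ∀ i j k, prodForm F (b _ i).1 (b _ j).1 (b _ k).1 = 0 :=
      fun i j k => congrFun (congrFun (congrFun h0 i) j) k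
    rw [← prodForm_apply, hb hp, hb hq, hb hr, trilinear_sum]
    simp [h0', F]

end Coefficients

/-! ### Infinitesimal rotations as derivations of the polynomial ring. -/

section Derivations

/-- The derivation of the polynomial ring which is the differential of `subst` at `1` in the
direction `A`. -/
noncomputable def lieDer (A : Matrix (Fin 3) (Fin 3) ℝ) :
    Derivation ℝ (MvPolynomial (Fin 3) ℝ) (MvPolynomial (Fin 3) ℝ) :=
  ∑ i, (∑ j, C (A j i) * X j : MvPolynomial (Fin 3) ℝ) • pderiv i

theorem lieDer_apply (A : Matrix (Fin 3) (Fin 3) ℝ) (h : MvPolynomial (Fin 3) ℝ) :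
    lieDer A h = ∑ i, (∑ j, C (A j i) * X j) * pderiv i h := by
  simp only [lieDer, ← Derivation.coeFnAddMonoidHom_apply, map_sum, Finset.sum_apply]
  simp

theorem lieDer_X (A : Matrix (Fin 3) (Fin 3) ℝ) (i : Fin 3) :
    lieDer A (X i) = ∑ j, C (A j i) * X j := by
  simp [lieDer_apply, pderiv_X, Pi.single_apply]

theorem isHomogeneous_lieDer (A : Matrix (Fin 3) (Fin 3) ℝ) {h : MvPolynomial (Fin 3) ℝ} {l : ℕ}
    (hh : h.IsHomogeneous l) : (lieDer A h).IsHomogeneous l := by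
  rw [lieDer_apply]
  refine IsHomogeneous.sum _ _ _ fun i _ => ?_
  have h1 : (∑ j, C (A j i) * X j : MvPolynomial (Fin 3) ℝ).IsHomogeneous 1 :=
    IsHomogeneous.sum _ _ _ fun _ _ => isHomogeneous_C_mul_X _ _
  rcases l with _ | l
  · rw [← totalDegree_zero_iff_isHomogeneous, totalDegree_eq_zero_iff_eq_C] at hh
    rw [hh, pderiv_C, mul_zero]
    exact isHomogeneous_zero _ _ _
  · rw [add_comm]
    exact h1.mul hh.pderiv

theorem pderiv_pderiv_comm (i j : Fin 3) (p : MvPolynomial (Fin 3) ℝ) :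
    pderiv i (pderiv j p) = pderiv j (pderiv i p) := by
  ext d
  simp only [coeff_pderiv, add_right_comm d (Finsupp.single j 1), Finsupp.add_apply,
    Finsupp.single_apply]
  by_cases h : i = j
  · rw [h]
  · simp [h, Ne.symm h]
    ring

theorem pderiv_lieDer (A : Matrix (Fin 3) (Fin 3) ℝ) (m : Fin 3) (p : MvPolynomial (Fin 3) ℝ) :
    pderiv m (lieDer A p) = lieDer A (pderiv m p) + ∑ i, C (A m i) * pderiv i p := by
  simp only [lieDer_apply, map_sum, Derivation.leibniz, smul_eq_mul, Finset.sum_add_distrib,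
    pderiv_C, mul_zero, add_zero, pderiv_X, Pi.single_apply, mul_ite, mul_one, Finset.sum_ite_eq',
    Finset.mem_univ, if_true, pderiv_pderiv_comm m]
  congr 1
  exact Finset.sum_congr rfl fun i _ => by simp [mul_comm]

/-- The commutator of the two operators is `2 ∑ A m i ∂_m ∂_i`, a skew matrix contracted with
symmetric second derivatives. -/
theorem laplacian_lieDer (A : Matrix (Fin 3) (Fin 3) ℝ) (hA : A.transpose = -A)
    (h : MvPolynomial (Fin 3) ℝ) : laplacian (lieDer A h) = lieDer A (laplacian h) := by
  have hA' : ∀ i j, (C (A i j) : MvPolynomial (Fin 3) ℝ) = - C (A j i) := by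
    intro i j
    have := congrFun (congrFun hA j) i
    rw [Matrix.transpose_apply, Matrix.neg_apply] at this
    rw [this, map_neg]
  simp only [laplacian, LinearMap.sum_apply, LinearMap.comp_apply, Derivation.coeFn_coe,
    pderiv_lieDer,
    map_add, map_sum, pderiv_C_mul, Finset.sum_add_distrib, add_assoc]
  rw [add_eq_left]
  simp only [Fin.sum_univ_three, pderiv_pderiv_comm 1 0, pderiv_pderiv_comm 2 0,
    pderiv_pderiv_comm 2 1]
  rw [hA' 1 0, hA' 2 0, hA' 2 1]
  have h0 : ∀ i, (C (A i i) : MvPolynomial (Fin 3) ℝ) = 0 := fun i => self_eq_neg.1 (hA' i i)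
  rw [h0, h0, h0]
  ring

theorem lie_lieDer (A B : Matrix (Fin 3) (Fin 3) ℝ) :
    ⁅lieDer A, lieDer B⁆ = lieDer (A * B - B * A) := by
  refine derivation_ext fun i => ?_
  rw [Derivation.commutator_apply]
  simp only [lieDer_X, Derivation.leibniz, smul_eq_mul, Fin.sum_univ_three,
    Matrix.sub_apply, Matrix.mul_apply, map_add, map_sub, map_mul,
    show ∀ (M : Matrix (Fin 3) (Fin 3) ℝ) a, lieDer M (C a) = 0 from
      fun M a => (lieDer M).map_algebraMap a]
  ring

/-- The generators of the rotations about the three axes. -/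
def rotGen : Fin 3 → Matrix (Fin 3) (Fin 3) ℝ :=
  ![!![0, 0, 0; 0, 0, -1; 0, 1, 0], !![0, 0, 1; 0, 0, 0; -1, 0, 0], !![0, -1, 0; 1, 0, 0; 0, 0, 0]]

theorem rotGen_transpose (a : Fin 3) : (rotGen a).transpose = -rotGen a := by
  ext i j
  fin_cases a <;> fin_cases i <;> fin_cases j <;> simp [rotGen]

theorem rotGen_commutator (a : Fin 3) :
    rotGen a * rotGen (a + 1) - rotGen (a + 1) * rotGen a = rotGen (a + 2) := by
  ext i j
  fin_cases a <;> fin_cases i <;> fin_cases j <;> simp [rotGen]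

/-- The infinitesimal rotation about an axis, acting on harmonic polynomials. -/
noncomputable def harmLie (l : ℕ) (a : Fin 3) : Module.End ℝ (Harm l) :=
  (lieDer (rotGen a)).toLinearMap.restrict fun h hh =>
    ⟨isHomogeneous_lieDer _ hh.1, by
      have h2 : laplacian h = 0 := hh.2
      change laplacian (lieDer (rotGen a) h) = 0
      rw [laplacian_lieDer _ (rotGen_transpose a), h2, map_zero]⟩

theorem harmLie_coe (l : ℕ) (a : Fin 3) (h : Harm l) :
    (harmLie l a h).1 = lieDer (rotGen a) h.1 := rfl

theorem harmLie_commutator (l : ℕ) (a : Fin 3) :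
    harmLie l a * harmLie l (a + 1) = harmLie l (a + 1) * harmLie l a + harmLie l (a + 2) := by
  ext1 h
  apply Subtype.ext
  have := congrArg (fun δ => δ h.1) (lie_lieDer (rotGen a) (rotGen (a + 1)))
  rw [rotGen_commutator] at this
  exact sub_eq_iff_eq_add'.1 this

end Derivations

/-! ### Differentiating the representations along axis rotations. -/

section Curves

/-- The rotation about a coordinate axis. -/
noncomputable def axisRotation (a : Fin 3) (θ : ℝ) : SO3 :=
  ⟨![!![1, 0, 0; 0, Real.cos θ, -Real.sin θ; 0, Real.sin θ, Real.cos θ],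
    !![Real.cos θ, 0, Real.sin θ; 0, 1, 0; -Real.sin θ, 0, Real.cos θ],
    !![Real.cos θ, -Real.sin θ, 0; Real.sin θ, Real.cos θ, 0; 0, 0, 1]] a, by
    have h := Real.sin_sq_add_cos_sq θ
    refine Matrix.mem_specialOrthogonalGroup_iff.2 ⟨?_, ?_⟩
    · rw [Matrix.mem_orthogonalGroup_iff]
      ext i j
      fin_cases a <;> fin_cases i <;> fin_cases j <;>
        simp [Matrix.mul_apply, Fin.sum_univ_three] <;> first | ring1 | linear_combination h
    · fin_cases a <;> simp [Matrix.det_fin_three] <;> linear_combination h⟩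

theorem axisRotation_zero (a : Fin 3) : axisRotation a 0 = 1 := by
  apply Subtype.ext
  ext i j
  fin_cases a <;> fin_cases i <;> fin_cases j <;> simp [axisRotation]

theorem hasDerivAt_axisRotation (a i j : Fin 3) :
    HasDerivAt (fun θ => (axisRotation a θ).1 i j) (rotGen a i j) 0 := by
  have hs : HasDerivAt Real.sin 1 0 := by simpa using Real.hasDerivAt_sin 0
  have hc : HasDerivAt Real.cos 0 0 := by simpa using Real.hasDerivAt_cos 0
  have hn : HasDerivAt (fun θ => -Real.sin θ) (-1) 0 := hs.neg
  fin_cases a <;> fin_cases i <;> fin_cases j <;> simp [axisRotation, rotGen] <;>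
    first | exact hs | exact hc | exact hn | exact hasDerivAt_const _ _

/-- Differentiation is done coefficient by coefficient, so no topology on polynomials is needed; the
product rule in `θ` matches the Leibniz rule of `lieDer`. -/
theorem hasDerivAt_coeff_subst (a : Fin 3) (p : MvPolynomial (Fin 3) ℝ) (d : Fin 3 →₀ ℕ) :
    HasDerivAt (fun θ => coeff d (subst (axisRotation a θ).1 p))
      (coeff d (lieDer (rotGen a) p)) 0 := by
  induction p using MvPolynomial.induction_on generalizing d with
  | C c =>
    have h1 : lieDer (rotGen a) (C c) = 0 := (lieDer (rotGen a)).map_algebraMap c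
    simp only [subst, aeval_C, h1, coeff_zero]
    exact hasDerivAt_const _ _
  | add p q hp hq => simpa using (hp d).fun_add (hq d)
  | mul_X p n hp =>
    have h1 : ∀ θ, coeff d (subst (axisRotation a θ).1 (p * X n))
        = ∑ j, (axisRotation a θ).1 j n * coeff d (subst (axisRotation a θ).1 p * X j) := by
      intro θ
      have : subst (axisRotation a θ).1 (X n) = ∑ j, C ((axisRotation a θ).1 j n) * X j := by
        simp [subst]
      rw [map_mul, this, Finset.mul_sum, coeff_sum]
      refine Finset.sum_congr rfl fun j _ => ?_
      rw [mul_left_comm, coeff_C_mul]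
    have h2 : ∀ j, HasDerivAt (fun θ => coeff d (subst (axisRotation a θ).1 p * X j))
        (coeff d (lieDer (rotGen a) p * X j)) 0 := by
      intro j
      simp only [coeff_mul_X']
      split_ifs
      · exact hp _
      · exact hasDerivAt_const _ _
    have h3 := HasDerivAt.fun_sum (u := Finset.univ) fun j _ =>
      (hasDerivAt_axisRotation a j n).fun_mul (h2 j)
    simp only [h1]
    refine h3.congr_deriv ?_
    · symm
      rw [Derivation.leibniz, lieDer_X]
      simp only [smul_eq_mul, axisRotation_zero, Finset.sum_add_distrib, Finset.mul_sum, coeff_add,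
        coeff_sum]
      congr 1
      · refine Finset.sum_congr rfl fun j _ => ?_
        have h4 : subst (1 : SO3).1 p = p := by
          change subst (1 : Matrix (Fin 3) (Fin 3) ℝ) p = p
          rw [subst_one]
          rfl
        rw [mul_left_comm, coeff_C_mul, h4]
      · simp [Matrix.one_apply, mul_comm]

theorem hasDerivAt_functional (a : Fin 3) {l : ℕ} (φ : Harm l →ₗ[ℝ] ℝ) (p : Harm l) :
    HasDerivAt (fun θ => φ (harmRep l (axisRotation a θ) p)) (φ (harmLie l a p)) 0 := by
  obtain ⟨ψ, hψ⟩ := LinearMap.exists_extend φ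
  have := finite_degree_eq l
  have hfin := Set.toFinite {d : Fin 3 →₀ ℕ | d.degree = l}
  -- Homogeneity fixes one finite set of exponents for all `q`, hence for all `θ`, so `φ` becomes a
  -- finite sum of coefficients that can be differentiated termwise.
  have h1 : ∀ q : Harm l, φ q = ∑ d ∈ hfin.toFinset, coeff d q.1 * ψ (monomial d 1) := by
    intro q
    have hq : q.1.IsHomogeneous l := q.2.1
    rw [← hψ, LinearMap.comp_apply, Submodule.subtype_apply]
    conv_lhs => rw [q.1.as_sum]
    rw [map_sum]
    have h2 : ∀ d c, ψ (monomial d c) = c * ψ (monomial d 1) := by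
      intro d c
      rw [← smul_eq_mul, ← map_smul, smul_monomial, smul_eq_mul, mul_one]
    simp only [h2 _ (coeff _ _)]
    refine Finset.sum_subset (fun d hd => ?_) fun d _ hd => ?_
    · rw [Set.Finite.mem_toFinset, Set.mem_ofPred_eq]
      by_contra hne
      exact (mem_support_iff.1 hd) (hq.coeff_eq_zero hne)
    · rw [notMem_support_iff.1 hd, zero_mul]
  simp only [h1]
  exact HasDerivAt.fun_sum fun d _ => (hasDerivAt_coeff_subst a p.1 d).mul_const _

/-- The matrix of an infinitesimal rotation. -/
noncomputable def lieMat (b : Coordinates) (l : ℕ) (a : Fin 3) :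
    Matrix (Fin (2 * l + 1)) (Fin (2 * l + 1)) ℝ :=
  LinearMap.toMatrixAlgEquiv (b l) (harmLie l a)

theorem hasDerivAt_D (b : Coordinates) (l : ℕ) (a : Fin 3) (i j : Fin (2 * l + 1)) :
    HasDerivAt (fun θ => D b l (axisRotation a θ) i j) (lieMat b l a i j) 0 := by
  have := hasDerivAt_functional a ((b l).coord i) (b l j)
  simpa [D, lieMat, LinearMap.toMatrix_apply, LinearMap.toMatrixAlgEquiv_apply] using this

theorem lieMat_commutator (b : Coordinates) (l : ℕ) (a : Fin 3) :
    lieMat b l a * lieMat b l (a + 1) = lieMat b l (a + 1) * lieMat b l a + lieMat b l (a + 2) := by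
  rw [lieMat, lieMat, lieMat, ← map_mul, harmLie_commutator, map_add, map_mul]

/-- The invariance identity has a left side constant in `θ`; its derivative at `0` has one term for
each of the three factors. -/
theorem IsInvariant.lieMat {b : Coordinates} {l₁ l₂ l₃ : ℕ}
    {C : Fin (2 * l₁ + 1) → Fin (2 * l₂ + 1) → Fin (2 * l₃ + 1) → ℝ}
    (hC : IsInvariant b l₁ l₂ l₃ C) (a : Fin 3) (l m n) :
    ∑ i, C i m n * lieMat b l₁ a i l + ∑ j, C l j n * lieMat b l₂ a j m
      + ∑ k, C l m k * lieMat b l₃ a k n = 0 := by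
  have h1 := HasDerivAt.fun_sum (u := Finset.univ) fun i _ =>
    HasDerivAt.fun_sum (u := Finset.univ) fun j _ =>
    HasDerivAt.fun_sum (u := Finset.univ) fun k _ =>
      (((hasDerivAt_D b l₁ a i l).const_mul (C i j k)).mul (hasDerivAt_D b l₂ a j m)).fun_mul
        (hasDerivAt_D b l₃ a k n)
  have h2 : HasDerivAt (fun _ : ℝ => C l m n) 0 0 := hasDerivAt_const _ _
  have h3 : (fun _ : ℝ => C l m n) = fun θ => ∑ i, ∑ j, ∑ k, C i j k *
      D b l₁ (axisRotation a θ) i l * D b l₂ (axisRotation a θ) j m *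
      D b l₃ (axisRotation a θ) k n := funext fun θ => hC _ l m n
  rw [h3] at h2
  have h4 := h2.unique h1
  simp only [Pi.mul_apply, axisRotation_zero, map_one, Matrix.one_apply, Finset.sum_add_distrib,
    mul_ite, ite_mul, mul_one, mul_zero, zero_mul, Finset.sum_ite_irrel, Finset.sum_const_zero,
    Finset.sum_ite_eq', Finset.mem_univ, if_true] at h4
  exact h4.symm

end Curves

/-! ### Highest-weight theory and uniqueness of invariant trilinear forms. -/

section Sl2

/-- An irreducible representation of `sl₂` of dimension `2l+1`, with a highest weight vector `v`
and a lowest weight vector `w`. -/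
structure WeightModule (V : Type*) [AddCommGroup V] [Module ℂ V] (l : ℕ) where
  /-- the raising operator -/
  E : Module.End ℂ V
  /-- the lowering operator -/
  F : Module.End ℂ V
  /-- the weight operator -/
  H : Module.End ℂ V
  /-- the highest weight vector -/
  v : V
  /-- the lowest weight vector -/
  w : V
  H_E : ∀ x, H (E x) = E (H x) + E x
  H_F : ∀ x, H (F x) = F (H x) - F x
  E_F : ∀ x, E (F x) = F (E x) + (2 : ℂ) • H x
  E_v : E v = 0
  F_w : F w = 0
  H_v : H v = (l : ℂ) • v
  H_w : H w = -(l : ℂ) • w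
  v_ne : v ≠ 0
  w_ne : w ≠ 0
  finrank_eq : Module.finrank ℂ V = 2 * l + 1

namespace WeightModule

variable {V : Type*} [AddCommGroup V] [Module ℂ V] {l : ℕ} (M : WeightModule V l)

/-- The module with raising and lowering operators exchanged. -/
def symm : WeightModule V l where
  E := M.F
  F := M.E
  H := -M.H
  v := M.w
  w := M.v
  H_E x := by simp [M.H_F]; abel
  H_F x := by simp [M.H_E]; abel
  E_F x := by simp [M.E_F]
  E_v := M.F_w
  F_w := M.E_v
  H_v := by simp [M.H_w]
  H_w := by simp [M.H_v]
  v_ne := M.w_ne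
  w_ne := M.v_ne
  finrank_eq := M.finrank_eq

theorem H_F_pow (k : ℕ) : M.H ((M.F ^ k) M.v) = ((l : ℂ) - k) • (M.F ^ k) M.v := by
  induction k with
  | zero => simp [M.H_v]
  | succ k ih =>
    rw [pow_succ', Module.End.mul_apply, M.H_F, ih, map_smul]
    push_cast
    module

theorem H_E_pow (k : ℕ) : M.H ((M.E ^ k) M.w) = ((k : ℂ) - l) • (M.E ^ k) M.w := by
  have := M.symm.H_F_pow k
  change -(M.H ((M.E ^ k) M.w)) = ((l : ℂ) - k) • (M.E ^ k) M.w at this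
  rw [← neg_inj, this]
  module

/-- Here `[E, F] = 2H` and `[H, E] = E`, so `H` is half the customary generator and its weights move
in unit steps. The factor first vanishes at `k = 2l`, hence the string from `v` has at least `2l +
1` nonzero vectors. -/
theorem E_F_pow (k : ℕ) :
    M.E ((M.F ^ (k + 1)) M.v) = (((k : ℂ) + 1) * (2 * l - k)) • (M.F ^ k) M.v := by
  induction k with
  | zero => simp [M.E_F, M.E_v, M.H_v, smul_smul]
  | succ k ih =>
    rw [pow_succ', Module.End.mul_apply, M.E_F, ih, map_smul, M.H_F_pow, ← Module.End.mul_apply,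
      ← pow_succ', smul_smul, ← add_smul]
    congr 1
    push_cast
    ring

theorem F_pow_ne_zero {k : ℕ} (hk : k ≤ 2 * l) : (M.F ^ k) M.v ≠ 0 := by
  induction k with
  | zero => simpa using M.v_ne
  | succ k ih =>
    intro h
    have h1 := M.E_F_pow k
    rw [h, map_zero, eq_comm, smul_eq_zero] at h1
    refine h1.elim (fun h2 => ?_) (ih (by omega))
    have h3 : (2 * l - k : ℂ) = ((2 * l - k : ℕ) : ℂ) := by
      rw [Nat.cast_sub (by omega)]; push_cast; ring
    rw [h3] at h2
    norm_cast at h2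
    simp at h2
    omega

/-- The vectors `F^k v` with `k ≤ 2l` are eigenvectors of `H` for distinct eigenvalues, and there
are as many of them as the dimension. -/
theorem span_F_pow : Submodule.span ℂ (Set.range fun k : ℕ => (M.F ^ k) M.v) = ⊤ := by
  have h1 : LinearIndependent ℂ fun k : Fin (2 * l + 1) => (M.F ^ (k : ℕ)) M.v :=
    Module.End.eigenvectors_linearIndependent' M.H (fun k : Fin (2 * l + 1) => (l : ℂ) - (k : ℕ))
      (fun i j h => by simpa [Fin.val_inj] using h) _
      fun k => ⟨Module.End.mem_eigenspace_iff.2 (M.H_F_pow k), M.F_pow_ne_zero (by omega)⟩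
  have h2 := h1.span_eq_top_of_card_eq_finrank (by rw [M.finrank_eq, Fintype.card_fin])
  rw [eq_top_iff, ← h2]
  exact Submodule.span_mono (Set.range_comp_subset_range _ fun k : ℕ => (M.F ^ k) M.v)

theorem span_E_pow : Submodule.span ℂ (Set.range fun k : ℕ => (M.E ^ k) M.w) = ⊤ :=
  M.symm.span_F_pow

end WeightModule

variable {V₁ V₂ V₃ : Type*} [AddCommGroup V₁] [Module ℂ V₁] [AddCommGroup V₂] [Module ℂ V₂]
  [AddCommGroup V₃] [Module ℂ V₃] {l₁ l₂ l₃ : ℕ}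

/-- Invariance of a trilinear form under an infinitesimal transformation. -/
def LieInvariant (T : V₁ →ₗ[ℂ] V₂ →ₗ[ℂ] V₃ →ₗ[ℂ] ℂ) (A₁ : Module.End ℂ V₁) (A₂ : Module.End ℂ V₂)
    (A₃ : Module.End ℂ V₃) : Prop :=
  ∀ x y z, T (A₁ x) y z + T x (A₂ y) z + T x y (A₃ z) = 0

theorem eq_zero_of_lieInvariant (M₁ : WeightModule V₁ l₁) (M₂ : WeightModule V₂ l₂)
    (M₃ : WeightModule V₃ l₃) (T : V₁ →ₗ[ℂ] V₂ →ₗ[ℂ] V₃ →ₗ[ℂ] ℂ)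
    (hE : LieInvariant T M₁.E M₂.E M₃.E) (hF : LieInvariant T M₁.F M₂.F M₃.F)
    (hH : LieInvariant T M₁.H M₂.H M₃.H)
    (h0 : ∀ n, n + l₃ = l₁ + l₂ → T M₁.w ((M₂.E ^ n) M₂.w) M₃.v = 0) : T = 0 := by
  -- Invariance under `H`: the form vanishes unless the weights `-l₁`, `n - l₂` and `l₃` add up to
  -- zero.
  have h1 : ∀ n, T M₁.w ((M₂.E ^ n) M₂.w) M₃.v = 0 := by
    intro n
    by_cases hn : n + l₃ = l₁ + l₂
    · exact h0 n hn
    · have h := hH M₁.w ((M₂.E ^ n) M₂.w) M₃.v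
      simp only [M₁.H_w, M₂.H_E_pow, M₃.H_v, map_smul, LinearMap.smul_apply, smul_eq_mul,
        ← add_mul] at h
      refine (mul_eq_zero.1 h).resolve_left fun h2 => hn ?_
      have h3 : ((n + l₃ : ℕ) : ℂ) = ((l₁ + l₂ : ℕ) : ℂ) := by
        push_cast
        linear_combination h2
      exact_mod_cast h3
  -- Since `E` kills `v₃`, invariance moves each `E` from the first slot to the second, up to sign.
  have h2 : ∀ k n, T ((M₁.E ^ k) M₁.w) ((M₂.E ^ n) M₂.w) M₃.v = 0 := by
    intro k
    induction k with
    | zero => exact h1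
    | succ k ih =>
      intro n
      have h := hE ((M₁.E ^ k) M₁.w) ((M₂.E ^ n) M₂.w) M₃.v
      rw [← Module.End.mul_apply, ← pow_succ', ← Module.End.mul_apply M₂.E, ← pow_succ',
        ih (n + 1), M₃.E_v, map_zero, add_zero, add_zero] at h
      exact h
  have h3 : ∀ x y, T x y M₃.v = 0 := by
    intro x y
    have hx : x ∈ Submodule.span ℂ (Set.range fun k : ℕ => (M₁.E ^ k) M₁.w) :=
      M₁.span_E_pow ▸ Submodule.mem_top
    have hy : y ∈ Submodule.span ℂ (Set.range fun k : ℕ => (M₂.E ^ k) M₂.w) :=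
      M₂.span_E_pow ▸ Submodule.mem_top
    induction hx using Submodule.span_induction with
    | zero => simp
    | add x x' _ _ hx hx' => simp [hx, hx']
    | smul c x _ hx => simp [hx]
    | mem x hx =>
      obtain ⟨k, rfl⟩ := hx
      induction hy using Submodule.span_induction with
      | zero => simp
      | add y y' _ _ hy hy' => simp [hy, hy']
      | smul c y _ hy => simp [hy]
      | mem y hy =>
        obtain ⟨n, rfl⟩ := hy
        exact h2 k n
  -- Invariance under `F` moves each `F` from the third slot to the first two, where the arguments
  -- are arbitrary.
  have h4 : ∀ k x y, T x y ((M₃.F ^ k) M₃.v) = 0 := by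
    intro k
    induction k with
    | zero => exact h3
    | succ k ih =>
      intro x y
      have h := hF x y ((M₃.F ^ k) M₃.v)
      rw [← Module.End.mul_apply M₃.F, ← pow_succ', ih, ih, zero_add, zero_add] at h
      exact h
  refine LinearMap.ext fun x => LinearMap.ext fun y => LinearMap.ext_on M₃.span_F_pow ?_
  rintro _ ⟨k, rfl⟩
  exact h4 k x y

end Sl2

/-! ### The complexified irrep as a weight module. -/

section Complexification

variable (b : Coordinates) (l : ℕ)

/-- An infinitesimal rotation on the complexified coordinate space. -/
noncomputable def lieC (a : Fin 3) : Module.End ℂ (Fin (2 * l + 1) → ℂ) :=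
  Matrix.toLinAlgEquiv' ((lieMat b l a).map Complex.ofRealHom)

theorem lieC_commutator (a : Fin 3) :
    lieC b l a * lieC b l (a + 1) = lieC b l (a + 1) * lieC b l a + lieC b l (a + 2) := by
  simp only [lieC, ← map_mul, ← map_add, ← Matrix.map_mul, lieMat_commutator]
  congr 1
  rw [Matrix.map_add _ (map_add _)]

variable {l}

/-- The coordinate vector of the complex linear combination `p + s q`. -/
noncomputable def complexVec (s : ℂ) (p q : Harm l) : Fin (2 * l + 1) → ℂ :=
  fun i => ((b l).repr p i : ℂ) + s * ((b l).repr q i : ℂ)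

theorem lieC_complexVec (a : Fin 3) (s : ℂ) (p q : Harm l) :
    lieC b l a (complexVec b s p q) = complexVec b s (harmLie l a p) (harmLie l a q) := by
  have h : ∀ p : Harm l, ∀ i, ((b l).repr (harmLie l a p) i : ℂ)
      = ∑ j, ((lieMat b l a i j : ℝ) : ℂ) * ((b l).repr p j : ℂ) := by
    intro p i
    have := congrFun (LinearMap.toMatrix_mulVec_repr (b l) (b l) (harmLie l a) p) i
    rw [← this]
    simp [Matrix.mulVec, dotProduct, lieMat, LinearMap.toMatrixAlgEquiv]
  ext i
  simp only [complexVec, h, lieC, Matrix.toLinAlgEquiv'_apply, Matrix.mulVec, dotProduct,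
    Matrix.map_apply, Finset.mul_sum, ← Finset.sum_add_distrib]
  refine Finset.sum_congr rfl fun j _ => ?_
  simp
  ring

variable (l)

/-- Real part of `(x + i y) ^ l`. -/
noncomputable def highestRe : Harm l :=
  ⟨_, (powParts_mem_harm ![1, 0, 0] ![0, 1, 0] (by simp [Fin.sum_univ_three])
    (by simp [Fin.sum_univ_three]) l).1⟩

/-- Imaginary part of `(x + i y) ^ l`. -/
noncomputable def highestIm : Harm l :=
  ⟨_, (powParts_mem_harm ![1, 0, 0] ![0, 1, 0] (by simp [Fin.sum_univ_three])
    (by simp [Fin.sum_univ_three]) l).2⟩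

theorem harmLie_highest :
    harmLie l 0 (highestRe l) = harmLie l 1 (highestIm l) ∧
    harmLie l 0 (highestIm l) = -harmLie l 1 (highestRe l) ∧
    harmLie l 2 (highestRe l) = (l : ℝ) • highestIm l ∧
    harmLie l 2 (highestIm l) = -((l : ℝ) • highestRe l) := by
  have hA : ∀ a, lieDer (rotGen a) (linForm ![1, 0, 0]) = lieDer (rotGen a) (X 0) := by
    intro a; simp [linForm, Fin.sum_univ_three]
  have hB : ∀ a, lieDer (rotGen a) (linForm ![0, 1, 0]) = lieDer (rotGen a) (X 1) := by
    intro a; simp [linForm, Fin.sum_univ_three]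
  refine ⟨Subtype.ext ?_, Subtype.ext ?_, Subtype.ext ?_, Subtype.ext ?_⟩ <;>
  · simp only [harmLie_coe, highestRe, highestIm, Submodule.coe_smul, Submodule.coe_neg]
    rcases l with _ | n
    · simp [powParts]
    · simp only [(derivation_powParts _ _ _ n).1, (derivation_powParts _ _ _ n).2, hA, hB, lieDer_X,
        Fin.sum_univ_three]
      simp [rotGen, powParts, linForm, Fin.sum_univ_three, smul_eq_C_mul]
      try ring

/-- A non-real `s` separates real and imaginary parts, so vanishing would make both parts of `(x +
iy)^l` zero; but this polynomial is 1 at `(1, 0, 0)`. -/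
theorem complexVec_highest_ne_zero (s : ℂ) (hs : s.im ≠ 0) :
    complexVec b s (highestRe l) (highestIm l) ≠ 0 := by
  intro h
  have h1 : ∀ i, (b l).repr (highestIm l) i = 0 ∧ (b l).repr (highestRe l) i = 0 := by
    intro i
    have h2 := congrFun h i
    have h3 := congrArg Complex.im h2
    have h4 := congrArg Complex.re h2
    simp [complexVec, hs] at h3 h4
    simp [h3] at h4
    exact ⟨h3, h4⟩
  have h2 : highestIm l = 0 := (b l).ext_elem fun i => by simp [(h1 i).1]
  have h3 : highestRe l = 0 := (b l).ext_elem fun i => by simp [(h1 i).2]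
  have h4 := map_powParts ![1, 0, 0] ![0, 1, 0] l
  have h5 : (powParts ![1, 0, 0] ![0, 1, 0] l).1 = 0 := congrArg Subtype.val h3
  have h6 : (powParts ![1, 0, 0] ![0, 1, 0] l).2 = 0 := congrArg Subtype.val h2
  rw [h5, h6, map_zero, mul_zero, add_zero] at h4
  have h7 := congrArg (MvPolynomial.eval ![1, 0, 0]) h4
  simp [Fin.sum_univ_three] at h7

theorem lieC_comm (x : Fin (2 * l + 1) → ℂ) :
    lieC b l 0 (lieC b l 1 x) = lieC b l 1 (lieC b l 0 x) + lieC b l 2 x ∧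
    lieC b l 1 (lieC b l 2 x) = lieC b l 2 (lieC b l 1 x) + lieC b l 0 x ∧
    lieC b l 2 (lieC b l 0 x) = lieC b l 0 (lieC b l 2 x) + lieC b l 1 x :=
  ⟨congrArg (fun f => f x) (lieC_commutator b l 0), congrArg (fun f => f x) (lieC_commutator b l 1),
    congrArg (fun f => f x) (lieC_commutator b l 2)⟩

/-- The complexified `l`-irrep. -/
noncomputable def weightModule : WeightModule (Fin (2 * l + 1) → ℂ) l where
  -- With these signs `H` is `i` times the generator about the third axis, and `(x + iy)^l` and `(x
  -- - iy)^l` have weights `l` and `-l`.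
  E := lieC b l 0 + Complex.I • lieC b l 1
  F := -lieC b l 0 + Complex.I • lieC b l 1
  H := Complex.I • lieC b l 2
  v := complexVec b Complex.I (highestRe l) (highestIm l)
  w := complexVec b (-Complex.I) (highestRe l) (highestIm l)
  H_E x := by
    obtain ⟨-, h1, h2⟩ := lieC_comm b l x
    simp only [LinearMap.add_apply, LinearMap.smul_apply, map_add, map_smul, h1, h2, smul_add,
      smul_smul, Complex.I_mul_I]
    module
  H_F x := by
    obtain ⟨-, h1, h2⟩ := lieC_comm b l x
    simp only [LinearMap.add_apply, LinearMap.neg_apply, LinearMap.smul_apply, map_add, map_neg,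
      map_smul, h1, h2, smul_add, smul_neg, smul_smul, Complex.I_mul_I]
    module
  E_F x := by
    obtain ⟨h0, -, -⟩ := lieC_comm b l x
    simp only [LinearMap.add_apply, LinearMap.neg_apply, LinearMap.smul_apply, map_add, map_neg,
      map_smul, h0, smul_add, smul_neg, smul_smul, Complex.I_mul_I]
    module
  E_v := by
    obtain ⟨h1, h2, -, -⟩ := harmLie_highest l
    simp only [LinearMap.add_apply, LinearMap.smul_apply, lieC_complexVec, h1, h2]
    ext i
    simp [complexVec]
    linear_combination ((b l).repr (harmLie l 1 (highestIm l)) i : ℂ) * Complex.I_mul_I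
  F_w := by
    obtain ⟨h1, h2, -, -⟩ := harmLie_highest l
    simp only [LinearMap.add_apply, LinearMap.neg_apply, LinearMap.smul_apply, lieC_complexVec, h1,
      h2]
    ext i
    simp [complexVec]
    linear_combination -((b l).repr (harmLie l 1 (highestIm l)) i : ℂ) * Complex.I_mul_I
  H_v := by
    obtain ⟨-, -, h1, h2⟩ := harmLie_highest l
    simp only [LinearMap.smul_apply, lieC_complexVec, h1, h2]
    ext i
    simp [complexVec]
    linear_combination -(l * (b l).repr (highestRe l) i : ℂ) * Complex.I_mul_I
  H_w := by
    obtain ⟨-, -, h1, h2⟩ := harmLie_highest l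
    simp only [LinearMap.smul_apply, lieC_complexVec, h1, h2]
    ext i
    simp [complexVec]
    linear_combination (l * (b l).repr (highestRe l) i : ℂ) * Complex.I_mul_I
  v_ne := complexVec_highest_ne_zero b l _ (by simp)
  w_ne := complexVec_highest_ne_zero b l _ (by simp)
  finrank_eq := by simp

end Complexification

/-! ### Invariant tensors: proportionality and the triangle inequality. -/

section Uniqueness

variable {b : Coordinates} {l₁ l₂ l₃ : ℕ}
  {C C' : Fin (2 * l₁ + 1) → Fin (2 * l₂ + 1) → Fin (2 * l₃ + 1) → ℝ}

/-- The complex trilinear form of a real tensor. -/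
noncomputable def triForm (C : Fin (2 * l₁ + 1) → Fin (2 * l₂ + 1) → Fin (2 * l₃ + 1) → ℝ) :
    (Fin (2 * l₁ + 1) → ℂ) →ₗ[ℂ] (Fin (2 * l₂ + 1) → ℂ) →ₗ[ℂ] (Fin (2 * l₃ + 1) → ℂ) →ₗ[ℂ] ℂ :=
  ∑ i, ∑ j, ∑ k, (LinearMap.proj i).smulRight
    ((LinearMap.proj j).smulRight ((C i j k : ℂ) • LinearMap.proj k))

theorem triForm_single (i j k) :
    triForm C (Pi.single i 1) (Pi.single j 1) (Pi.single k 1) = C i j k := by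
  simp [triForm, LinearMap.sum_apply, Pi.single_apply, Finset.sum_ite_irrel]

theorem lieC_single (b : Coordinates) (l : ℕ) (a : Fin 3) (j : Fin (2 * l + 1)) :
    lieC b l a (Pi.single j 1) = ∑ i, (lieMat b l a i j : ℂ) • Pi.single i 1 := by
  ext i
  simp [lieC, Pi.single_apply]

theorem IsInvariant.lieInvariant (hC : IsInvariant b l₁ l₂ l₃ C) (a : Fin 3) :
    LieInvariant (triForm C) (lieC b l₁ a) (lieC b l₂ a) (lieC b l₃ a) := by
  have key : ∀ l m n, triForm C (lieC b l₁ a (Pi.single l 1)) (Pi.single m 1) (Pi.single n 1)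
      + triForm C (Pi.single l 1) (lieC b l₂ a (Pi.single m 1)) (Pi.single n 1)
      + triForm C (Pi.single l 1) (Pi.single m 1) (lieC b l₃ a (Pi.single n 1)) = 0 := by
    intro l m n
    have h := congrArg (fun r : ℝ => (r : ℂ)) (hC.lieMat a l m n)
    simp only [lieC_single, map_sum, LinearMap.sum_apply, map_smul, LinearMap.smul_apply,
      triForm_single, smul_eq_mul]
    push_cast at h
    simpa only [mul_comm] using h
  have hx : ∀ {m : ℕ} (x : Fin m → ℂ), x = ∑ i, x i • Pi.single i 1 := fun x => by
    ext i; simp [Pi.single_apply]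
  intro x y z
  have h1 : ∀ {l : ℕ} (x : Fin (2 * l + 1) → ℂ),
      lieC b l a x = ∑ i, x i • lieC b l a (Pi.single i 1) := fun x => by
    conv_lhs => rw [hx x]
    rw [map_sum]
    simp only [map_smul]
  rw [h1 x, h1 y, h1 z]
  conv_lhs =>
    enter [1, 1]
    rw [hx y, hx z]
  conv_lhs =>
    enter [1, 2]
    rw [hx x, hx z]
  conv_lhs =>
    enter [2]
    rw [hx x, hx y]
  simp only [trilinear_sum, ← Finset.sum_add_distrib, ← add_mul, key, zero_mul,
    Finset.sum_const_zero]

theorem LieInvariant.add {V₁ V₂ V₃ : Type*} [AddCommGroup V₁] [Module ℂ V₁] [AddCommGroup V₂]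
    [Module ℂ V₂] [AddCommGroup V₃] [Module ℂ V₃] {T : V₁ →ₗ[ℂ] V₂ →ₗ[ℂ] V₃ →ₗ[ℂ] ℂ}
    {A₁ B₁ : Module.End ℂ V₁} {A₂ B₂ : Module.End ℂ V₂} {A₃ B₃ : Module.End ℂ V₃}
    (hA : LieInvariant T A₁ A₂ A₃) (hB : LieInvariant T B₁ B₂ B₃) :
    LieInvariant T (A₁ + B₁) (A₂ + B₂) (A₃ + B₃) := by
  intro x y z
  simp only [LinearMap.add_apply, map_add]
  linear_combination hA x y z + hB x y z

theorem LieInvariant.smul {V₁ V₂ V₃ : Type*} [AddCommGroup V₁] [Module ℂ V₁] [AddCommGroup V₂]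
    [Module ℂ V₂] [AddCommGroup V₃] [Module ℂ V₃] {T : V₁ →ₗ[ℂ] V₂ →ₗ[ℂ] V₃ →ₗ[ℂ] ℂ}
    {A₁ : Module.End ℂ V₁} {A₂ : Module.End ℂ V₂} {A₃ : Module.End ℂ V₃}
    (hA : LieInvariant T A₁ A₂ A₃) (c : ℂ) : LieInvariant T (c • A₁) (c • A₂) (c • A₃) := by
  intro x y z
  simp only [LinearMap.smul_apply, map_smul, smul_eq_mul]
  linear_combination c * hA x y z

theorem LieInvariant.neg {V₁ V₂ V₃ : Type*} [AddCommGroup V₁] [Module ℂ V₁] [AddCommGroup V₂]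
    [Module ℂ V₂] [AddCommGroup V₃] [Module ℂ V₃] {T : V₁ →ₗ[ℂ] V₂ →ₗ[ℂ] V₃ →ₗ[ℂ] ℂ}
    {A₁ : Module.End ℂ V₁} {A₂ : Module.End ℂ V₂} {A₃ : Module.End ℂ V₃}
    (hA : LieInvariant T A₁ A₂ A₃) : LieInvariant T (-A₁) (-A₂) (-A₃) := by
  intro x y z
  simp only [LinearMap.neg_apply, map_neg]
  linear_combination -hA x y z

theorem LieInvariant.comb {V₁ V₂ V₃ : Type*} [AddCommGroup V₁] [Module ℂ V₁] [AddCommGroup V₂]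
    [Module ℂ V₂] [AddCommGroup V₃] [Module ℂ V₃] {T T' : V₁ →ₗ[ℂ] V₂ →ₗ[ℂ] V₃ →ₗ[ℂ] ℂ}
    {A₁ : Module.End ℂ V₁} {A₂ : Module.End ℂ V₂} {A₃ : Module.End ℂ V₃}
    (hT : LieInvariant T A₁ A₂ A₃) (hT' : LieInvariant T' A₁ A₂ A₃) (c c' : ℂ) :
    LieInvariant (c • T - c' • T') A₁ A₂ A₃ := by
  intro x y z
  simp only [LinearMap.sub_apply, LinearMap.smul_apply, smul_eq_mul]
  linear_combination c * hT x y z - c' * hT' x y z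

theorem eq_zero_of_lieC_invariant (b : Coordinates)
    {T : (Fin (2 * l₁ + 1) → ℂ) →ₗ[ℂ] (Fin (2 * l₂ + 1) → ℂ) →ₗ[ℂ] (Fin (2 * l₃ + 1) → ℂ) →ₗ[ℂ] ℂ}
    (hT : ∀ a, LieInvariant T (lieC b l₁ a) (lieC b l₂ a) (lieC b l₃ a))
    (h0 : ∀ n, n + l₃ = l₁ + l₂ → T (weightModule b l₁).w
      (((weightModule b l₂).E ^ n) (weightModule b l₂).w) (weightModule b l₃).v = 0) : T = 0 := by
  refine eq_zero_of_lieInvariant (weightModule b l₁) (weightModule b l₂) (weightModule b l₃) T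
    ?_ ?_ ?_ h0
  · exact (hT 0).add ((hT 1).smul _)
  · exact (hT 0).neg.add ((hT 1).smul _)
  · exact (hT 2).smul _

theorem eq_zero_of_triForm_eq_zero (h : triForm C = 0) : C = 0 := by
  funext i j k
  have := triForm_single (C := C) i j k
  rw [h] at this
  simpa using this.symm

theorem IsInvariant.proportional (hC : IsInvariant b l₁ l₂ l₃ C) (hC' : IsInvariant b l₁ l₂ l₃ C')
    (hne : C ≠ 0) : ∃ r : ℝ, ∀ i j k, C' i j k = r * C i j k := by
  -- The functional `ev` is injective on invariant forms. If `l₃ > l₁ + l₂`, the truncated exponent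
  -- is irrelevant, since every invariant form is then zero.
  let ev := fun T : (Fin (2 * l₁ + 1) → ℂ) →ₗ[ℂ] (Fin (2 * l₂ + 1) → ℂ) →ₗ[ℂ]
      (Fin (2 * l₃ + 1) → ℂ) →ₗ[ℂ] ℂ =>
    T (weightModule b l₁).w
      (((weightModule b l₂).E ^ (l₁ + l₂ - l₃)) (weightModule b l₂).w) (weightModule b l₃).v
  have hev : ∀ T, (∀ a, LieInvariant T (lieC b l₁ a) (lieC b l₂ a) (lieC b l₃ a)) → ev T = 0 →
      T = 0 := by
    intro T hT h
    refine eq_zero_of_lieC_invariant b hT fun n hn => ?_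
    rw [show n = l₁ + l₂ - l₃ by omega]
    exact h
  have ht : ev (triForm C) ≠ 0 := fun h =>
    hne (eq_zero_of_triForm_eq_zero (hev _ hC.lieInvariant h))
  -- This combination of the two forms is invariant and killed by `ev`, hence zero.
  have h := hev (ev (triForm C) • triForm C' - ev (triForm C') • triForm C)
    (fun a => (hC'.lieInvariant a).comb (hC.lieInvariant a) _ _) (by
      simp only [ev, LinearMap.sub_apply, LinearMap.smul_apply, smul_eq_mul]
      ring)
  have h1 : ∀ i j k, ev (triForm C) * C' i j k = ev (triForm C') * C i j k := by
    intro i j k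
    have h2 := congrArg (fun T => T (Pi.single i 1) (Pi.single j 1) (Pi.single k 1)) h
    simp only [LinearMap.sub_apply, LinearMap.smul_apply, triForm_single, smul_eq_mul,
      LinearMap.zero_apply] at h2
    exact sub_eq_zero.1 h2
  obtain ⟨i, hi⟩ := Function.ne_iff.1 hne
  obtain ⟨j, hj⟩ := Function.ne_iff.1 hi
  obtain ⟨k, hk⟩ := Function.ne_iff.1 hj
  change C i j k ≠ 0 at hk
  -- The ratio supplied by `ev` is a priori complex; comparison at one nonzero entry of `C` shows
  -- that it is real.
  refine ⟨C' i j k / C i j k, fun i' j' k' => ?_⟩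
  have hk' : (C i j k : ℂ) ≠ 0 := Complex.ofReal_ne_zero.2 hk
  have h3 : (C' i' j' k' : ℂ) = (C' i j k / C i j k * C i' j' k' : ℂ) := by
    apply mul_left_cancel₀ ht
    rw [h1, eq_div_of_mul_eq hk' (h1 i j k).symm]
    ring
  exact_mod_cast h3

theorem IsInvariant.le_add (hC : IsInvariant b l₁ l₂ l₃ C) (hne : C ≠ 0) : l₃ ≤ l₁ + l₂ := by
  by_contra h
  exact hne (eq_zero_of_triForm_eq_zero
    (eq_zero_of_lieC_invariant b hC.lieInvariant fun n hn => by omega))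

theorem IsInvariant.rotate (hC : IsInvariant b l₁ l₂ l₃ C) :
    IsInvariant b l₂ l₃ l₁ fun j k i => C i j k := by
  intro R m n l
  refine (hC R l m n).trans ?_
  rw [Finset.sum_comm]
  refine Finset.sum_congr rfl fun j _ => ?_
  rw [Finset.sum_comm]
  exact Finset.sum_congr rfl fun k _ => Finset.sum_congr rfl fun i _ => by ring

/-- The bound `l₃ ≤ l₁ + l₂` applied to the three cyclic rotations of the tensor. -/
theorem IsInvariant.triangle (hC : IsInvariant b l₁ l₂ l₃ C) (hne : C ≠ 0) :
    Triangle l₁ l₂ l₃ := by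
  have h1 := hC.le_add hne
  have h2 := hC.rotate.le_add fun h => hne <| by
    funext i j k; exact congrFun (congrFun (congrFun h j) k) i
  have h3 := hC.rotate.rotate.le_add fun h => hne <| by
    funext i j k; exact congrFun (congrFun (congrFun h k) i) j
  refine ⟨?_, h1⟩
  rw [abs_le]
  omega

end Uniqueness

/-! ### Schur's lemma from the case `l₃ = 0`. -/

section ClebschGordan

theorem D_zero (b : Coordinates) (R : SO3) : D b 0 R = 1 := by
  have h : harmRep 0 R = 1 := by
    ext1 h
    apply Subtype.ext
    have h0 : h.1.IsHomogeneous 0 := h.2.1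
    rw [← totalDegree_zero_iff_isHomogeneous, totalDegree_eq_zero_iff_eq_C] at h0
    change subst R.1 h.1 = h.1
    rw [h0]
    simp [subst]
  change LinearMap.toMatrix (b 0) (b 0) (harmRep 0 R) = 1
  rw [h, LinearMap.toMatrix_one]

variable {b : Coordinates}

/-- Schur's lemma: an invariant bilinear form on an irrep is a multiple of the standard one. -/
theorem eq_smul_one_of_invariant (hb : b.IsOrthogonal) {l : ℕ}
    (G : Matrix (Fin (2 * l + 1)) (Fin (2 * l + 1)) ℝ)
    (hG : ∀ R, (D b l R).transpose * G * D b l R = G) : ∃ r : ℝ, G = r • 1 := by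
  have key : ∀ G : Matrix (Fin (2 * l + 1)) (Fin (2 * l + 1)) ℝ,
      (∀ R, (D b l R).transpose * G * D b l R = G) →
      IsInvariant b l l 0 fun i j _ => G i j := by
    intro G hG R i j k
    obtain rfl : k = 0 := Fin.ext (by omega)
    conv_lhs => rw [← hG R]
    simp only [Matrix.mul_apply, Matrix.transpose_apply, D_zero, Finset.sum_mul]
    rw [Finset.sum_comm]
    refine Finset.sum_congr rfl fun x _ => Finset.sum_congr rfl fun y _ => ?_
    rw [Fintype.sum_eq_single 0 fun z hz => absurd (Fin.ext (by omega)) hz, Matrix.one_apply_eq]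
    ring
  -- Orthogonality makes the identity matrix one nonzero invariant form; uniqueness makes every
  -- other a real multiple of it.
  obtain ⟨r, hr⟩ := (key 1 fun R => by
    rw [mul_one]; exact (Matrix.mem_orthogonalGroup_iff' _ _).1 (hb l R)).proportional (key G hG)
      fun h => by simpa using congrFun (congrFun (congrFun h 0) 0) 0
  exact ⟨r, by ext i j; exact hr i j 0⟩

end ClebschGordan

end E3nn

namespace E3nn

open scoped Kronecker

/-! ### Bilinear maps as matrices on the tensor product. -/

section TensorMatrix

variable {n₁ n₂ n₃ : ℕ}

/-- The matrix `S_{k,(i,j)} = C_{ijk}` of a tensor. -/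
def tensorMat (C : Fin n₁ → Fin n₂ → Fin n₃ → ℝ) : Matrix (Fin n₃) (Fin n₁ × Fin n₂) ℝ :=
  Matrix.of fun k x => C x.1 x.2 k

/-- The tensor product of two vectors. -/
def outer (x : Fin n₁ → ℝ) (y : Fin n₂ → ℝ) : Fin n₁ × Fin n₂ → ℝ := fun p => x p.1 * y p.2

theorem tensorMat_mulVec_outer (C : Fin n₁ → Fin n₂ → Fin n₃ → ℝ) (x : Fin n₁ → ℝ)
    (y : Fin n₂ → ℝ) (k : Fin n₃) :
    (tensorMat C).mulVec (outer x y) k = ∑ i, ∑ j, C i j k * x i * y j := by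
  simp only [Matrix.mulVec, dotProduct, Fintype.sum_prod_type, tensorMat, outer, Matrix.of_apply,
    mul_assoc]

theorem kronecker_mulVec_outer {m₁ m₂ : ℕ} (A : Matrix (Fin m₁) (Fin n₁) ℝ)
    (B : Matrix (Fin m₂) (Fin n₂) ℝ) (x : Fin n₁ → ℝ) (y : Fin n₂ → ℝ) :
    (A ⊗ₖ B).mulVec (outer x y) = outer (A.mulVec x) (B.mulVec y) := by
  ext p
  simp only [Matrix.mulVec, dotProduct, Fintype.sum_prod_type, outer, Matrix.kroneckerMap_apply,
    Finset.sum_mul_sum]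
  exact Finset.sum_congr rfl fun i _ => Finset.sum_congr rfl fun j _ => by ring

theorem outer_single (i : Fin n₁) (j : Fin n₂) :
    outer (Pi.single i 1) (Pi.single j 1) = Pi.single (i, j) 1 := by
  ext ⟨i', j'⟩
  by_cases h : i' = i <;> by_cases h' : j' = j <;> simp [outer, h, h']

theorem bilinear_eq_mulVec_outer (F : (Fin n₁ → ℝ) →ₗ[ℝ] (Fin n₂ → ℝ) →ₗ[ℝ] (Fin n₃ → ℝ))
    (x : Fin n₁ → ℝ) (y : Fin n₂ → ℝ) :
    F x y = (tensorMat fun i j => F (Pi.single i 1) (Pi.single j 1)).mulVec (outer x y) := by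
  ext k
  rw [tensorMat_mulVec_outer]
  have hx : ∀ {m : ℕ} (x : Fin m → ℝ), x = ∑ i, x i • Pi.single i 1 := fun x => by
    ext i; simp [Pi.single_apply]
  conv_lhs => rw [hx x, hx y, map_sum F, LinearMap.sum_apply]
  rw [Finset.sum_apply]
  refine Finset.sum_congr rfl fun i _ => ?_
  rw [map_sum, Finset.sum_apply]
  refine Finset.sum_congr rfl fun j _ => ?_
  simp only [map_smul, LinearMap.smul_apply, Pi.smul_apply, smul_eq_mul]
  ring

theorem mul_kronecker_eq_of_equivariant
    (F : (Fin n₁ → ℝ) →ₗ[ℝ] (Fin n₂ → ℝ) →ₗ[ℝ] (Fin n₃ → ℝ)) (A₁ : Matrix (Fin n₁) (Fin n₁) ℝ)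
    (A₂ : Matrix (Fin n₂) (Fin n₂) ℝ) (A₃ : Matrix (Fin n₃) (Fin n₃) ℝ)
    (h : ∀ x y, F (A₁.mulVec x) (A₂.mulVec y) = A₃.mulVec (F x y)) :
    (tensorMat fun i j => F (Pi.single i 1) (Pi.single j 1)) * (A₁ ⊗ₖ A₂)
      = A₃ * tensorMat fun i j => F (Pi.single i 1) (Pi.single j 1) := by
  set S := tensorMat fun i j => F (Pi.single i 1) (Pi.single j 1) with hS
  refine Matrix.ext_of_mulVec_single fun p => ?_
  rw [← outer_single p.1 p.2, ← Matrix.mulVec_mulVec, kronecker_mulVec_outer, hS,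
    ← bilinear_eq_mulVec_outer, h, bilinear_eq_mulVec_outer, Matrix.mulVec_mulVec]

end TensorMatrix

/-! ### Existence of Clebsch–Gordan coefficients. -/

section ClebschGordanExistence

variable {b : Coordinates} {l₁ l₂ l₃ : ℕ}
  {C : Fin (2 * l₁ + 1) → Fin (2 * l₂ + 1) → Fin (2 * l₃ + 1) → ℝ}

theorem isInvariant_iff : IsInvariant b l₁ l₂ l₃ C ↔
    ∀ R, tensorMat C = (D b l₃ R).transpose * (tensorMat C * (D b l₁ R ⊗ₖ D b l₂ R)) := by
  have h : ∀ R l m n, ((D b l₃ R).transpose * (tensorMat C * (D b l₁ R ⊗ₖ D b l₂ R))) n (l, m)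
      = ∑ i, ∑ j, ∑ k, C i j k * D b l₁ R i l * D b l₂ R j m * D b l₃ R k n := by
    intro R l m n
    simp only [Matrix.mul_apply, Fintype.sum_prod_type, Finset.mul_sum, Matrix.transpose_apply,
      Matrix.kroneckerMap_apply, tensorMat, Matrix.of_apply]
    rw [Finset.sum_comm]
    refine Finset.sum_congr rfl fun i _ => ?_
    rw [Finset.sum_comm]
    exact Finset.sum_congr rfl fun j _ => Finset.sum_congr rfl fun k _ => by ring
  constructor
  · intro hC R
    ext n ⟨l, m⟩
    rw [h]
    exact hC R l m n
  · intro hC R l m n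
    rw [← h, ← hC]
    rfl

theorem isInvariant_iff_mul (hb : b.IsOrthogonal) : IsInvariant b l₁ l₂ l₃ C ↔
    ∀ R, tensorMat C * (D b l₁ R ⊗ₖ D b l₂ R) = D b l₃ R * tensorMat C := by
  rw [isInvariant_iff]
  refine forall_congr' fun R => ⟨fun h => ?_, fun h => ?_⟩
  · conv_rhs => rw [h]
    rw [← Matrix.mul_assoc, (Matrix.mem_orthogonalGroup_iff _ _).1 (hb l₃ R), Matrix.one_mul]
  · rw [h, ← Matrix.mul_assoc, (Matrix.mem_orthogonalGroup_iff' _ _).1 (hb l₃ R), Matrix.one_mul]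

theorem kronecker_mul_transpose (hb : b.IsOrthogonal) (R : SO3) :
    (D b l₁ R ⊗ₖ D b l₂ R) * (D b l₁ R ⊗ₖ D b l₂ R).transpose = 1 := by
  rw [← Matrix.kroneckerMap_transpose, ← Matrix.mul_kronecker_mul,
    (Matrix.mem_orthogonalGroup_iff _ _).1 (hb l₁ R),
    (Matrix.mem_orthogonalGroup_iff _ _).1 (hb l₂ R), Matrix.one_kronecker_one]

theorem IsInvariant.gram_eq_smul_one (hb : b.IsOrthogonal) (hC : IsInvariant b l₁ l₂ l₃ C) :
    ∃ r : ℝ, tensorMat C * (tensorMat C).transpose = r • 1 := by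
  refine eq_smul_one_of_invariant hb _ fun R => ?_
  conv_rhs => rw [isInvariant_iff.1 hC R]
  simp only [Matrix.transpose_mul, Matrix.transpose_transpose, Matrix.mul_assoc]
  rw [← Matrix.mul_assoc (D b l₁ R ⊗ₖ D b l₂ R), kronecker_mul_transpose hb, Matrix.one_mul]

/-- By Schur's lemma the Gram matrix of a nonzero invariant tensor is `r • 1`, with `r > 0` because
its diagonal entries are sums of squares; dividing by `√r` makes it the identity. -/
theorem exists_isClebschGordan (hb : b.IsOrthogonal) (h : Triangle l₁ l₂ l₃) :
    ∃ C, IsClebschGordan b l₁ l₂ l₃ C := by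
  obtain ⟨C, hC, hne⟩ := exists_isInvariant_ne_zero b h
  obtain ⟨r, hr⟩ := hC.gram_eq_smul_one hb
  have hsum : ∀ k k', ∑ i, ∑ j, C i j k * C i j k' = if k = k' then r else 0 := by
    intro k k'
    have := congrFun (congrFun hr k) k'
    simpa [Matrix.mul_apply, Fintype.sum_prod_type, tensorMat, Matrix.one_apply] using this
  have hr0 : 0 < r := by
    obtain ⟨i, hi⟩ := Function.ne_iff.1 hne
    obtain ⟨j, hj⟩ := Function.ne_iff.1 hi
    obtain ⟨k, hk⟩ := Function.ne_iff.1 hj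
    rw [← if_pos (rfl : k = k) (c := k = k) (t := r) (e := 0), ← hsum k k]
    refine Finset.sum_pos' (fun i _ => Finset.sum_nonneg fun j _ => mul_self_nonneg _)
      ⟨i, Finset.mem_univ _, Finset.sum_pos' (fun j _ => mul_self_nonneg _)
        ⟨j, Finset.mem_univ _, mul_self_pos.2 hk⟩⟩
  refine ⟨fun i j k => (Real.sqrt r)⁻¹ * C i j k, fun R l m n => ?_, fun k k' => ?_⟩
  · change (Real.sqrt r)⁻¹ * C l m n = _
    rw [hC R l m n]
    simp only [Finset.mul_sum, mul_assoc]
  · have : ∀ i j, (Real.sqrt r)⁻¹ * C i j k * ((Real.sqrt r)⁻¹ * C i j k')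
        = r⁻¹ * (C i j k * C i j k') := by
      intro i j
      rw [mul_mul_mul_comm, ← mul_inv, Real.mul_self_sqrt hr0.le]
    simp only [this, ← Finset.mul_sum, hsum]
    split_ifs
    · exact inv_mul_cancel₀ hr0.ne'
    · exact mul_zero _

theorem IsClebschGordan.ne_zero (hC : IsClebschGordan b l₁ l₂ l₃ C) : C ≠ 0 := by
  rintro rfl
  simpa using hC.2 0 0

end ClebschGordanExistence

/-! ### Selection rules, and equivariant maps as sums over paths. -/

section Equivariance

variable {b : Coordinates}

/-- The sign by which `Irrep.mat` differs from the matrix of the underlying rotation. -/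
noncomputable def Irrep.sign (ρ : Irrep) (R : O3) : ℝ :=
  if R.1.det = 1 then 1 else ((ρ.p : ℤ) : ℝ)

theorem Irrep.mat_eq (ρ : Irrep) (R : O3) :
    ρ.mat b R = ρ.sign R • D b ρ.l (rotationPart R) := rfl

theorem kronecker_mat (ρ₁ ρ₂ : Irrep) (R : O3) :
    ρ₁.mat b R ⊗ₖ ρ₂.mat b R = (ρ₁.sign R * ρ₂.sign R) •
      (D b ρ₁.l (rotationPart R) ⊗ₖ D b ρ₂.l (rotationPart R)) := by
  rw [Irrep.mat_eq, Irrep.mat_eq, Matrix.smul_kronecker, Matrix.kronecker_smul, smul_smul]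

/-- Rotations as elements of `O(3)`. -/
def rotationToO3 (R : SO3) : O3 := ⟨R.1, (Matrix.mem_specialOrthogonalGroup_iff.1 R.2).1⟩

theorem mat_rotationToO3 (ρ : Irrep) (R : SO3) : ρ.mat b (rotationToO3 R) = D b ρ.l R := by
  have hdet : R.1.det = 1 := (Matrix.mem_specialOrthogonalGroup_iff.1 R.2).2
  have h : rotationPart (rotationToO3 R) = R := by
    apply Subtype.ext
    change R.1.det • R.1 = R.1
    rw [hdet, one_smul]
  rw [Irrep.mat_eq, h, Irrep.sign, if_pos (show (rotationToO3 R).1.det = 1 from hdet),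
    one_smul]

/-- The inversion. -/
def inversion : O3 := ⟨-1, by simp [Matrix.mem_orthogonalGroup_iff]⟩

theorem det_inversion : inversion.1.det = -1 := by
  simp only [inversion, Matrix.det_neg, Fintype.card_fin, Matrix.det_one]
  norm_num

theorem mat_inversion (ρ : Irrep) : ρ.mat b inversion = ((ρ.p : ℤ) : ℝ) • 1 := by
  have h : rotationPart inversion = 1 := by
    apply Subtype.ext
    change inversion.1.det • inversion.1 = 1
    rw [det_inversion]
    simp [inversion]
  rw [Irrep.mat_eq, h, map_one, Irrep.sign, det_inversion, if_neg (by norm_num)]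

theorem sign_mul_sign {ρ₁ ρ₂ ρ₃ : Irrep} (h : ρ₁.p * ρ₂.p = ρ₃.p) (R : O3) :
    ρ₁.sign R * ρ₂.sign R = ρ₃.sign R := by
  simp only [Irrep.sign, ← h]
  split_ifs <;> simp

variable {ρ₁ ρ₂ ρ₃ : Irrep} {C : Fin ρ₁.dim → Fin ρ₂.dim → Fin ρ₃.dim → ℝ}

theorem tensorMat_mul_mat (hb : b.IsOrthogonal) (hC : IsInvariant b ρ₁.l ρ₂.l ρ₃.l C)
    (h : ρ₁.p * ρ₂.p = ρ₃.p) (R : O3) :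
    tensorMat C * (ρ₁.mat b R ⊗ₖ ρ₂.mat b R) = ρ₃.mat b R * tensorMat C := by
  rw [kronecker_mat, Irrep.mat_eq, Matrix.mul_smul, (isInvariant_iff_mul hb).1 hC,
    sign_mul_sign h, Matrix.smul_mul]

theorem isInvariant_of_mul_mat (hb : b.IsOrthogonal)
    (h : ∀ R, tensorMat C * (ρ₁.mat b R ⊗ₖ ρ₂.mat b R) = ρ₃.mat b R * tensorMat C) :
    IsInvariant b ρ₁.l ρ₂.l ρ₃.l C := by
  rw [isInvariant_iff_mul hb]
  intro R
  simpa only [mat_rotationToO3] using h (rotationToO3 R)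

/-- Rotations give the triangle inequality. The inversion acts on each irrep by its parity, so
comparing one nonzero entry of the tensor gives the parity rule. -/
theorem allowed_of_mul_mat (hb : b.IsOrthogonal)
    (h : ∀ R, tensorMat C * (ρ₁.mat b R ⊗ₖ ρ₂.mat b R) = ρ₃.mat b R * tensorMat C)
    (hne : C ≠ 0) : Allowed ρ₁ ρ₂ ρ₃ := by
  refine ⟨(isInvariant_of_mul_mat hb h).triangle hne, ?_⟩
  have h1 := h inversion
  rw [mat_inversion, mat_inversion, mat_inversion, Matrix.smul_kronecker, Matrix.kronecker_smul,
    Matrix.one_kronecker_one, smul_smul, Matrix.mul_smul, Matrix.mul_one, Matrix.smul_mul,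
    Matrix.one_mul] at h1
  obtain ⟨i, hi⟩ := Function.ne_iff.1 hne
  obtain ⟨j, hj⟩ := Function.ne_iff.1 hi
  obtain ⟨k, hk⟩ := Function.ne_iff.1 hj
  have h2 := congrFun (congrFun h1 k) (i, j)
  have h3 := mul_right_cancel₀ (show C i j k ≠ 0 from hk) h2
  apply Units.ext
  push_cast
  exact_mod_cast h3

variable {n₁ n₂ n₃ : ℕ} {σ₁ : Fin n₁ → Irrep} {σ₂ : Fin n₂ → Irrep} {σ₃ : Fin n₃ → Irrep}

theorem act_single (b : Coordinates) {n : ℕ} (σ : Fin n → Irrep) (R : O3) (u : Fin n)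
    (x : Fin (σ u).dim → ℝ) :
    act b σ R (Pi.single u x) = Pi.single u (((σ u).mat b R).mulVec x) := by
  funext a
  by_cases h : a = u
  · subst h; simp [act]
  · simp [act, h]

/-- The block of a bilinear map which takes the inputs `u` and `v` to the output `w`. -/
def block (f : Space σ₁ →ₗ[ℝ] Space σ₂ →ₗ[ℝ] Space σ₃) (u : Fin n₁) (v : Fin n₂) (w : Fin n₃) :
    (Fin (σ₁ u).dim → ℝ) →ₗ[ℝ] (Fin (σ₂ v).dim → ℝ) →ₗ[ℝ] (Fin (σ₃ w).dim → ℝ) :=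
  (f.compl₁₂ (LinearMap.single ℝ _ u) (LinearMap.single ℝ _ v)).compr₂ (LinearMap.proj w)

theorem block_apply (f : Space σ₁ →ₗ[ℝ] Space σ₂ →ₗ[ℝ] Space σ₃) (u v w x y) :
    block f u v w x y = f (Pi.single u x) (Pi.single v y) w := rfl

theorem apply_eq_sum_block (f : Space σ₁ →ₗ[ℝ] Space σ₂ →ₗ[ℝ] Space σ₃) (x : Space σ₁)
    (y : Space σ₂) (w : Fin n₃) : f x y w = ∑ u, ∑ v, block f u v w (x u) (y v) := by
  simp only [block_apply]
  conv_lhs => rw [← Finset.univ_sum_single x, ← Finset.univ_sum_single y, map_sum f,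
    LinearMap.sum_apply, Finset.sum_apply]
  refine Finset.sum_congr rfl fun u _ => ?_
  rw [map_sum, Finset.sum_apply]

theorem IsEquivariant.block {f : Space σ₁ →ₗ[ℝ] Space σ₂ →ₗ[ℝ] Space σ₃}
    (hf : IsEquivariant b f) (u v w) (R : O3) (x y) :
    block f u v w (((σ₁ u).mat b R).mulVec x) (((σ₂ v).mat b R).mulVec y)
      = ((σ₃ w).mat b R).mulVec (block f u v w x y) := by
  simp only [block_apply, ← act_single, hf R]
  rfl

theorem TensorProductClass.eval_apply (T : TensorProductClass σ₁ σ₂ σ₃) (C : Coefficients)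
    (x : Space σ₁) (y : Space σ₂) (w : Fin n₃) : T.eval C x y w = ∑ u, ∑ v,
      if (u, v, w) ∈ T.paths then T.weight u v w •
        (tensorMat (C (σ₁ u).l (σ₂ v).l (σ₃ w).l)).mulVec (outer (x u) (y v)) else 0 := by
  funext k
  simp only [TensorProductClass.eval, Finset.sum_apply]
  refine Finset.sum_congr rfl fun u _ => Finset.sum_congr rfl fun v _ => ?_
  split_ifs
  · rw [Pi.smul_apply, tensorMat_mulVec_outer, smul_eq_mul]
  · rfl

variable {C : Coefficients}

theorem TensorProductClass.eval_act (hb : b.IsOrthogonal)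
    (hC : ∀ l₁ l₂ l₃, Triangle l₁ l₂ l₃ → IsClebschGordan b l₁ l₂ l₃ (C l₁ l₂ l₃))
    (T : TensorProductClass σ₁ σ₂ σ₃) (R : O3) (x : Space σ₁) (y : Space σ₂) :
    T.eval C (act b σ₁ R x) (act b σ₂ R y) = act b σ₃ R (T.eval C x y) := by
  funext w
  rw [act, T.eval_apply, T.eval_apply, Matrix.mulVec_sum]
  refine Finset.sum_congr rfl fun u _ => ?_
  rw [Matrix.mulVec_sum]
  refine Finset.sum_congr rfl fun v _ => ?_
  split_ifs with h
  · obtain ⟨htri, hp⟩ := T.allowed _ h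
    rw [act, act, ← kronecker_mulVec_outer, Matrix.mulVec_mulVec, Matrix.mulVec_smul,
      tensorMat_mul_mat hb (hC _ _ _ htri).1 hp, Matrix.mulVec_mulVec]
  · rw [Matrix.mulVec_zero]

theorem IsEquivariant.exists_eval (hb : b.IsOrthogonal)
    (hC : ∀ l₁ l₂ l₃, Triangle l₁ l₂ l₃ → IsClebschGordan b l₁ l₂ l₃ (C l₁ l₂ l₃))
    {f : Space σ₁ →ₗ[ℝ] Space σ₂ →ₗ[ℝ] Space σ₃} (hf : IsEquivariant b f) :
    ∃ T : TensorProductClass σ₁ σ₂ σ₃, ∀ x y, f x y = T.eval C x y := by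
  classical
  have key : ∀ u v w, ∃ r : ℝ, Allowed (σ₁ u) (σ₂ v) (σ₃ w) → ∀ x y, E3nn.block f u v w x y
      = r • (tensorMat (C (σ₁ u).l (σ₂ v).l (σ₃ w).l)).mulVec (outer x y) := by
    intro u v w
    by_cases h : Allowed (σ₁ u) (σ₂ v) (σ₃ w)
    · have hcg := hC _ _ _ h.1
      obtain ⟨r, hr⟩ := IsInvariant.proportional hcg.1 (isInvariant_of_mul_mat hb fun R =>
        mul_kronecker_eq_of_equivariant _ _ _ _ (hf.block u v w R)) hcg.ne_zero
      refine ⟨r, fun _ x y => ?_⟩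
      rw [bilinear_eq_mulVec_outer, ← Matrix.smul_mulVec]
      congr 1
      ext k p
      exact hr p.1 p.2 k
    · exact ⟨0, fun h' => absurd h' h⟩
  choose r hr using key
  refine ⟨⟨Finset.univ.filter fun q => Allowed (σ₁ q.1) (σ₂ q.2.1) (σ₃ q.2.2),
    fun q hq => (Finset.mem_filter.1 hq).2, r⟩, fun x y => ?_⟩
  funext w
  rw [apply_eq_sum_block, TensorProductClass.eval_apply]
  refine Finset.sum_congr rfl fun u _ => Finset.sum_congr rfl fun v _ => ?_
  split_ifs with h
  · exact hr u v w (Finset.mem_filter.1 h).2 _ _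
  -- A nonzero equivariant block would satisfy the selection rules, so off the paths the block
  -- vanishes.
  · have h0 : (fun i j => E3nn.block f u v w (Pi.single i 1) (Pi.single j 1)) = 0 := by
      by_contra hne
      refine h (Finset.mem_filter.2 ⟨Finset.mem_univ _, allowed_of_mul_mat hb (fun R =>
        mul_kronecker_eq_of_equivariant _ _ _ _ (hf.block u v w R)) hne⟩)
    rw [bilinear_eq_mulVec_outer, h0]
    ext k
    rw [tensorMat_mulVec_outer]
    simp

end Equivariance

end E3nn

theorem mainTheorem1 :
    -- orthogonal real coordinates of the irreps exist
    (∃ b : E3nn.Coordinates, b.IsOrthogonal) ∧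
    ∀ b : E3nn.Coordinates, b.IsOrthogonal →
      -- in any such coordinates, each triple satisfying the triangle inequality has
      -- Clebsch–Gordan coefficients
      (∃ C : E3nn.Coefficients, ∀ l₁ l₂ l₃, E3nn.Triangle l₁ l₂ l₃ →
        E3nn.IsClebschGordan b l₁ l₂ l₃ (C l₁ l₂ l₃)) ∧
      -- and, whichever are chosen, the bilinear equivariant maps are exactly the weighted sums of
      -- allowed paths
      ∀ C : E3nn.Coefficients,
        (∀ l₁ l₂ l₃, E3nn.Triangle l₁ l₂ l₃ →
          E3nn.IsClebschGordan b l₁ l₂ l₃ (C l₁ l₂ l₃)) →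
        ∀ (n₁ n₂ n₃ : ℕ) (ρ₁ : Fin n₁ → E3nn.Irrep) (ρ₂ : Fin n₂ → E3nn.Irrep)
          (ρ₃ : Fin n₃ → E3nn.Irrep)
          (f : E3nn.Space ρ₁ →ₗ[ℝ] E3nn.Space ρ₂ →ₗ[ℝ] E3nn.Space ρ₃),
          E3nn.IsEquivariant b f ↔
            ∃ T : E3nn.TensorProductClass ρ₁ ρ₂ ρ₃, ∀ x y, f x y = T.eval C x y := by
  refine ⟨E3nn.exists_isOrthogonal, fun b hb => ⟨?_, fun C hC n₁ n₂ n₃ ρ₁ ρ₂ ρ₃ f =>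
    ⟨fun hf => hf.exists_eval hb hC, ?_⟩⟩⟩
  · classical
    refine ⟨fun l₁ l₂ l₃ => if h : E3nn.Triangle l₁ l₂ l₃ then
      (E3nn.exists_isClebschGordan hb h).choose else 0, fun l₁ l₂ l₃ h => ?_⟩
    simp only [dif_pos h]
    exact (E3nn.exists_isClebschGordan hb h).choose_spec
  · rintro ⟨T, hT⟩ R x y
    rw [hT, hT, T.eval_act hb hC]
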